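/- Let $n\ge 1$, $1<p<\infty$ and $0<\varepsilon<1$. There is a constant $C=C(n,p,\varepsilon)>0$ with the following property. Let $0<s<1$, let $\emptyset\ne G\subset\mathbb R^n$ be open, and let $R:G\to\mathbb R$ be a measurable function with $0\le R(x)\le \operatorname{dist}(x,\partial G)$ for every $x\in G$, where $\operatorname{dist}(x,\emptyset)=\infty$. For $f\in L^p(G)$ (real-valued) and $x\in G$ put $$M_R(f)(x)=\sup_{0\le r\le R(x)}\ \frac1{|B(x,r)|}\int_{B(x,r)}|f(y)|\,dy,$$ where $B(x,r)$ is the open ball and the average is understood to be $|f(x)|$ when $r=0$. Then, for every $f\in L^p(G)$, the function $M_R(f)$ is measurable and finite almost everywhere on $G$, and $$\int_G\int_G\frac{|M_R(f)(x)-M_R(f)(y)|^p}{(|x-y|+|R(x)-R(y)|)^{\varepsilon+sp}}\,\frac{dy\,dx}{|x-y|^{n-\varepsilon}}\le C\,|f|_{W^{s,p}(G)}^p,$$ where $$|f|_{W^{s,p}(G)}=\left(\int_G\int_G\frac{|f(x)-f(y)|^p}{|x-y|^{n+sp}}\,dy\,dx\right)^{1/p}\in[0,\infty].$$ In particular $C$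 does not depend on $s$, $G$, $R$ or $f$. -/

import Mathlib

open MeasureTheory
open scoped ENNReal

noncomputable section

/-- The integral average of `|f|` over the open ball `B(x,r)` with respect to Lebesgue measure,
with the convention that the average over a ball of radius `0` is `|f(x)|`. -/
def ballAverage {n : ℕ} (f : EuclideanSpace ℝ (Fin n) → ℝ) (x : EuclideanSpace ℝ (Fin n))
    (r : ℝ) : ℝ≥0∞ :=
  if r = 0 then ‖f x‖ₑ else ⨍⁻ y, ‖f y‖ₑ ∂(volume.restrict (Metric.ball x r))

/-- The maximal function `M_R(f)(x)`: the supremum, in `[0,∞]`, of the averages of `|f|` over the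
balls `B(x,r)` with `0 ≤ r ≤ R(x)`. -/
def maximalR {n : ℕ} (R f : EuclideanSpace ℝ (Fin n) → ℝ) (x : EuclideanSpace ℝ (Fin n)) : ℝ≥0∞ :=
  ⨆ (r : ℝ) (_ : 0 ≤ r ∧ r ≤ R x), ballAverage f x r

/-- `R` is a Lebesgue measurable function on `G` with `0 ≤ R(x) ≤ dist(x, ∂G)` for every `x ∈ G`.
The distance takes values in `[0,∞]`, and the distance to the empty set is `∞`. Only the values of
`R` on `G` matter. (For Lebesgue measure, `AEMeasurable` is the same as Lebesgue measurable.) -/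
structure IsAdmissibleRadius {n : ℕ} (G : Set (EuclideanSpace ℝ (Fin n)))
    (R : EuclideanSpace ℝ (Fin n) → ℝ) : Prop where
  measurable : AEMeasurable R (volume.restrict G)
  nonneg : ∀ x ∈ G, 0 ≤ R x
  le_dist : ∀ x ∈ G, ENNReal.ofReal (R x) ≤ Metric.infEDist x (frontier G)

/-- The fractional Sobolev seminorm `|f|_{W^{s,p}(G)}`, with values in `[0,∞]`. -/
def fracSobolevSeminorm {n : ℕ} (s p : ℝ) (G : Set (EuclideanSpace ℝ (Fin n)))
    (f : EuclideanSpace ℝ (Fin n) → ℝ) : ℝ≥0∞ :=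
  (∫⁻ x in G, ∫⁻ y in G, ‖f x - f y‖ₑ ^ p / ‖x - y‖ₑ ^ ((n : ℝ) + s * p)) ^ (1 / p)

end

/-!
Put `ρ = |x - y| + |R x - R y|` and compare the mean of `|f|` over `B(x, r)` with the mean over
`B(y, r - ρ)`, or with `|f y|` if `r ≤ ρ`. For `r ≤ |x - y|` the difference is controlled by the
difference quotient `w ↦ |f y - f w| / |y - w|^γ` and its maximal function at `x`. For larger `r` it
is controlled by the mean oscillation of `f` at the scale `min r ρ` and the maximal function of this
oscillation; averaging over the neighbouring scales replaces it by an integral over all scales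
`t > |x - y|` with weight `t^{-(ε + s p) - 1}`. In the double integral over `x` and `y`, the
Hardy–Littlewood theorem removes the maximal functions, and as `|x - y|^{ε - n}` is locally
integrable, integrating out `y` and then `t` leaves the Gagliardo energy of `f`.
-/

open Metric Set Module

section PowerIntegrals

theorem rpow_eq_mul_lintegral_Ioi {q : ℝ} (hq : 0 < q) (a : ℝ≥0∞) :
    a ^ q = ENNReal.ofReal q *
      ∫⁻ t in Ioi (0 : ℝ), {t | ENNReal.ofReal t < a}.indicator (ENNReal.ofReal · ^ (q - 1)) t := by
  have hle (b : ℝ) (hb : 0 ≤ b) : ENNReal.ofReal b ^ q = ENNReal.ofReal q * ∫⁻ t in Ioi (0 : ℝ),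
      {t | ENNReal.ofReal t < ENNReal.ofReal b}.indicator (ENNReal.ofReal · ^ (q - 1)) t := by
    have h := lintegral_rpow_eq_lintegral_meas_lt_mul (Measure.dirac ()) (f := fun _ => b)
      (ae_of_all _ fun _ => hb) aemeasurable_const hq
    rw [lintegral_dirac, ← ENNReal.ofReal_rpow_of_nonneg hb hq.le] at h
    rw [h]
    congr 1
    refine setLIntegral_congr_fun measurableSet_Ioi fun t (ht : 0 < t) => ?_
    by_cases htb : t < b <;>
      simp [htb, ENNReal.ofReal_lt_ofReal_iff', ht.trans, ENNReal.ofReal_rpow_of_pos ht]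
  induction a with
  | coe a => simpa using hle a a.2
  | top =>
    rw [ENNReal.top_rpow_of_pos hq, eq_comm]
    refine ENNReal.eq_top_of_forall_nnreal_le fun r => ?_
    calc (r : ℝ≥0∞) = ENNReal.ofReal ((r : ℝ) ^ q⁻¹) ^ q := by
          rw [ENNReal.ofReal_rpow_of_nonneg (by positivity) hq.le,
            Real.rpow_inv_rpow r.coe_nonneg hq.ne', ENNReal.ofReal_coe_nnreal]
      _ ≤ _ := by
          rw [hle _ (by positivity)]
          gcongr
          exact le_top

theorem lintegral_rpow_eq_mul_lintegral_meas_lt {α : Type*} [MeasurableSpace α] (μ : Measure α)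
    [SFinite μ] {g : α → ℝ≥0∞} (hg : Measurable g) {q : ℝ} (hq : 0 < q) :
    ∫⁻ x, g x ^ q ∂μ = ENNReal.ofReal q *
      ∫⁻ t in Ioi (0 : ℝ), ENNReal.ofReal t ^ (q - 1) * μ {x | ENNReal.ofReal t < g x} := by
  have hmeas : Measurable (Function.uncurry fun (x : α) (t : ℝ) =>
      {t | ENNReal.ofReal t < g x}.indicator (ENNReal.ofReal · ^ (q - 1)) t) :=
    Measurable.indicator (f := fun z : α × ℝ => ENNReal.ofReal z.2 ^ (q - 1)) (by fun_prop)
      (measurableSet_lt (f := fun z : α × ℝ => ENNReal.ofReal z.2) (by fun_prop) (by fun_prop))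
  simp only [rpow_eq_mul_lintegral_Ioi hq (g _)]
  rw [lintegral_const_mul _ hmeas.lintegral_prod_right, lintegral_lintegral_swap hmeas.aemeasurable]
  congr 1
  refine lintegral_congr fun t => ?_
  exact lintegral_indicator_const (measurableSet_lt measurable_const hg) _

theorem setLIntegral_Ioi_ofReal_rpow {q b : ℝ} (hq : 0 < q) (hb : 0 < b) :
    ∫⁻ t in Ioi b, ENNReal.ofReal t ^ (-(q + 1)) =
      ENNReal.ofReal b ^ (-q) / ENNReal.ofReal q := by
  have hq' : -(q + 1) < -1 := by linarith
  have hrpow : ∫⁻ t in Ioi b, ENNReal.ofReal t ^ (-(q + 1)) =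
      ∫⁻ t in Ioi b, ENNReal.ofReal (t ^ (-(q + 1))) :=
    setLIntegral_congr_fun measurableSet_Ioi fun t ht =>
      ENNReal.ofReal_rpow_of_pos (hb.trans ht)
  rw [hrpow, ← ofReal_integral_eq_lintegral_ofReal (integrableOn_Ioi_rpow_of_lt hq' hb)
    (ae_restrict_of_forall_mem measurableSet_Ioi fun t ht =>
      Real.rpow_nonneg (hb.trans ht).le _), integral_Ioi_rpow_of_lt hq' hb,
    ENNReal.ofReal_rpow_of_pos hb, ← ENNReal.ofReal_div_of_pos hq]
  rw [neg_add, neg_add_cancel_right, neg_div_neg_eq]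

end PowerIntegrals

theorem rpow_setLIntegral_le {α : Type*} [MeasurableSpace α] {μ : Measure α} {p : ℝ} (hp : 1 < p)
    {g : α → ℝ≥0∞} (hg : AEMeasurable g μ) (s : Set α) :
    (∫⁻ x in s, g x ∂μ) ^ p ≤ μ s ^ (p - 1) * ∫⁻ x in s, g x ^ p ∂μ := by
  have hp0 : 0 < p := by linarith
  have holder := ENNReal.lintegral_mul_le_Lp_mul_Lq (μ.restrict s)
    (Real.HolderConjugate.conjExponent hp) hg.restrict (aemeasurable_const (b := (1 : ℝ≥0∞)))
  simp only [Pi.mul_apply, mul_one, ENNReal.one_rpow, lintegral_one,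
    Measure.restrict_apply_univ] at holder
  calc (∫⁻ x in s, g x ∂μ) ^ p
      ≤ ((∫⁻ x in s, g x ^ p ∂μ) ^ (1 / p) * μ s ^ (1 / p.conjExponent)) ^ p := by gcongr
    _ = μ s ^ (p - 1) * ∫⁻ x in s, g x ^ p ∂μ := by
      rw [ENNReal.mul_rpow_of_nonneg _ _ hp0.le, ← ENNReal.rpow_mul, ← ENNReal.rpow_mul,
        one_div_mul_cancel hp0.ne', ENNReal.rpow_one, mul_comm]
      congr 2
      have : p - 1 ≠ 0 := by linarith
      unfold Real.conjExponent
      field_simp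

section BallAverages

variable {X : Type*} [PseudoMetricSpace X] [MeasurableSpace X] (μ : Measure X)

theorem measurable_setLIntegral_ball [OpensMeasurableSpace X] [SecondCountableTopology X]
    [SFinite μ] {α : Type*} [MeasurableSpace α] {F : α → X → ℝ≥0∞}
    (hF : Measurable (Function.uncurry F)) {c : α → X} (hc : Measurable c) {r : α → ℝ}
    (hr : Measurable r) : Measurable fun a => ∫⁻ y in ball (c a) (r a), F a y ∂μ := by
  simp_rw [← lintegral_indicator measurableSet_ball]
  refine Measurable.lintegral_prod_right' (f := fun z : α × X =>
    (ball (c z.1) (r z.1)).indicator (F z.1) z.2) ?_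
  have hs : MeasurableSet {z : α × X | dist z.2 (c z.1) < r z.1} :=
    measurableSet_lt (by fun_prop) (by fun_prop)
  exact hF.indicator hs

theorem measurable_setLAverage_ball [OpensMeasurableSpace X] [SecondCountableTopology X]
    [SFinite μ] {α : Type*} [MeasurableSpace α] {F : α → X → ℝ≥0∞}
    (hF : Measurable (Function.uncurry F)) {c : α → X} (hc : Measurable c) {r : α → ℝ}
    (hr : Measurable r) : Measurable fun a => ⨍⁻ y in ball (c a) (r a), F a y ∂μ := by
  have hμ : Measurable fun a => μ (ball (c a) (r a)) := by
    simpa only [setLIntegral_one] using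
      measurable_setLIntegral_ball μ (F := fun _ _ => 1) measurable_const hc hr
  simp only [setLAverage_eq]
  exact (measurable_setLIntegral_ball μ hF hc hr).div hμ

theorem setLAverage_ball_le_iSup_rat (g : X → ℝ≥0∞) (x : X) (r : ℝ) :
    ⨍⁻ y in ball x r, g y ∂μ ≤
      ⨆ (q : ℚ) (_ : 0 < (q : ℝ) ∧ (q : ℝ) < r), ⨍⁻ y in ball x q, g y ∂μ := by
  have hball : ball x r = ⋃ q : {q : ℚ // 0 < (q : ℝ) ∧ (q : ℝ) < r}, ball x (q : ℝ) := by
    refine Subset.antisymm (fun y hy => ?_) (iUnion_subset fun q => ball_subset_ball q.2.2.le)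
    obtain ⟨q, hq, hqr⟩ := exists_rat_btwn (mem_ball.1 hy)
    exact mem_iUnion.2 ⟨⟨q, dist_nonneg.trans_lt hq, hqr⟩, hq⟩
  have hdir : Directed (· ⊆ ·) fun q : {q : ℚ // 0 < (q : ℝ) ∧ (q : ℝ) < r} => ball x (q : ℝ) :=
    Monotone.directed_le fun q q' h => ball_subset_ball (by exact_mod_cast h)
  rw [setLAverage_eq, hball, setLIntegral_iUnion_of_directed _ hdir, ← hball, ENNReal.iSup_div]
  refine iSup_le fun q => le_iSup₂_of_le q.1 q.2 ?_
  rw [setLAverage_eq]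
  exact ENNReal.div_le_div_left (measure_mono (ball_subset_ball q.2.2.le)) _

end BallAverages

section MaximalFunction

variable {X : Type*} [PseudoMetricSpace X] [MeasurableSpace X] (μ : Measure X)

/-- The centred Hardy–Littlewood maximal function of `g : X → [0, ∞]`. Radii `r ≤ 0` contribute
nothing, because the average over the empty ball is `0`. -/
noncomputable def hlMaximal (g : X → ℝ≥0∞) (x : X) : ℝ≥0∞ :=
  ⨆ r : ℝ, ⨍⁻ y in ball x r, g y ∂μ

theorem setLAverage_ball_le_hlMaximal (g : X → ℝ≥0∞) (x : X) (r : ℝ) :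
    ⨍⁻ y in ball x r, g y ∂μ ≤ hlMaximal μ g x :=
  le_iSup (fun r : ℝ => ⨍⁻ y in ball x r, g y ∂μ) r

theorem hlMaximal_eq_iSup_rat (g : X → ℝ≥0∞) (x : X) :
    hlMaximal μ g x = ⨆ q : ℚ, ⨍⁻ y in ball x q, g y ∂μ :=
  le_antisymm
    (iSup_le fun r => (setLAverage_ball_le_iSup_rat μ g x r).trans <|
      iSup₂_le fun q _ => le_iSup (fun q : ℚ => ⨍⁻ y in ball x q, g y ∂μ) q)
    (iSup_le fun q => setLAverage_ball_le_hlMaximal μ g x q)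

theorem measurable_hlMaximal [OpensMeasurableSpace X] [SecondCountableTopology X] [SFinite μ]
    {α : Type*} [MeasurableSpace α] {F : α → X → ℝ≥0∞} (hF : Measurable (Function.uncurry F))
    {c : α → X} (hc : Measurable c) : Measurable fun a => hlMaximal μ (F a) (c a) := by
  simp only [hlMaximal_eq_iSup_rat]
  exact .iSup fun q => measurable_setLAverage_ball μ hF hc measurable_const

theorem hlMaximal_le_indicator_add [OpensMeasurableSpace X] (g : X → ℝ≥0∞) (t : ℝ≥0∞) (x : X) :
    hlMaximal μ g x ≤ hlMaximal μ ({y | t < g y}.indicator g) x + t := by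
  refine iSup_le fun r => le_trans ?_
    (add_le_add_left (setLAverage_ball_le_hlMaximal μ ({y | t < g y}.indicator g) x r) t)
  have hle (y : X) : g y ≤ {y | t < g y}.indicator g y + t := by
    by_cases hy : t < g y
    · simp [hy]
    · simpa [hy] using not_lt.1 hy
  calc ⨍⁻ y in ball x r, g y ∂μ
      ≤ ⨍⁻ y in ball x r, ({y | t < g y}.indicator g y + t) ∂μ :=
        laverage_mono_ae (ae_of_all _ hle)
    _ = ⨍⁻ y in ball x r, {y | t < g y}.indicator g y ∂μ + t * μ (ball x r) / μ (ball x r) := by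
        rw [setLAverage_eq, setLAverage_eq, lintegral_add_right _ measurable_const,
          setLIntegral_const, ENNReal.add_div]
    _ ≤ ⨍⁻ y in ball x r, {y | t < g y}.indicator g y ∂μ + t := by
        rw [mul_div_assoc]
        gcongr
        exact mul_le_of_le_one_right' ENNReal.div_self_le_one

end MaximalFunction

section MaximalTheorem

variable {E : Type*} [NormedAddCommGroup E] [NormedSpace ℝ E] [FiniteDimensional ℝ E]
  [MeasurableSpace E] [BorelSpace E] (μ : Measure E) [μ.IsAddHaarMeasure]

theorem addHaar_closedBall_five_mul (x : E) {r : ℝ} (hr : 0 < r) :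
    μ (closedBall x (5 * r)) = 5 ^ finrank ℝ E * μ (ball x r) := by
  rw [Measure.addHaar_closedBall _ _ (by positivity), Measure.addHaar_ball_of_pos _ _ hr, mul_pow,
    ENNReal.ofReal_mul (by positivity), mul_assoc, ENNReal.ofReal_pow (by norm_num),
    ENNReal.ofReal_ofNat]

theorem mul_measure_le_of_forall_lt_setLAverage (g : E → ℝ≥0∞) (t : ℝ≥0∞) {S : Set E} {N : ℝ}
    (hS : ∀ x ∈ S, ∃ r ≤ N, t < ⨍⁻ y in ball x r, g y ∂μ) :
    t * μ S ≤ 5 ^ finrank ℝ E * ∫⁻ x, g x ∂μ := by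
  choose! r hrN hr using hS
  have hr0 : ∀ x ∈ S, 0 < r x := fun x hx => by
    by_contra! h
    simpa [ball_eq_empty.2 h] using hr x hx
  obtain ⟨u, huS, hdisj, hcov⟩ := Vitali.exists_disjoint_subfamily_covering_enlargement_closedBall
    S id r N hrN 5 (by norm_num)
  have hu : u.Countable := hdisj.countable_of_nonempty_interior fun x hx =>
    ⟨x, ball_subset_interior_closedBall (mem_ball_self (hr0 x (huS hx)))⟩
  have hsub : S ⊆ ⋃ x ∈ u, closedBall x (5 * r x) := fun x hx => by
    obtain ⟨b, hb, hxb⟩ := hcov x hx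
    exact mem_iUnion₂.2 ⟨b, hb, hxb (mem_closedBall_self (hr0 x hx).le)⟩
  have hball (x : u) : t * μ (closedBall (x : E) (5 * r x)) ≤
      5 ^ finrank ℝ E * ∫⁻ y in closedBall (x : E) (r x), g y ∂μ := by
    rw [addHaar_closedBall_five_mul μ _ (hr0 x (huS x.2)), mul_left_comm]
    gcongr
    have hrx := setLAverage_eq μ g (ball (x : E) (r x)) ▸ hr x (huS x.2)
    exact (ENNReal.mul_le_of_le_div hrx.le).trans (lintegral_mono_set ball_subset_closedBall)
  have := hu.to_subtype
  calc t * μ S ≤ t * ∑' x : u, μ (closedBall (x : E) (5 * r x)) := by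
        gcongr
        exact (measure_mono hsub).trans (measure_biUnion_le μ hu _)
    _ ≤ ∑' x : u, 5 ^ finrank ℝ E * ∫⁻ y in closedBall (x : E) (r x), g y ∂μ := by
        rw [← ENNReal.tsum_mul_left]
        exact ENNReal.tsum_le_tsum hball
    _ = 5 ^ finrank ℝ E * ∫⁻ y in ⋃ x ∈ u, closedBall x (r x), g y ∂μ := by
        rw [ENNReal.tsum_mul_left, lintegral_biUnion (s := fun x => closedBall x (r x)) hu
          (fun x _ => measurableSet_closedBall) hdisj]
    _ ≤ 5 ^ finrank ℝ E * ∫⁻ x, g x ∂μ := by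
        gcongr
        exact Measure.restrict_le_self

theorem mul_measure_lt_hlMaximal_le (g : E → ℝ≥0∞) (t : ℝ≥0∞) :
    t * μ {x | t < hlMaximal μ g x} ≤ 5 ^ finrank ℝ E * ∫⁻ x, g x ∂μ := by
  let S (N : ℕ) : Set E := {x | ∃ r ≤ (N : ℝ), t < ⨍⁻ y in ball x r, g y ∂μ}
  have hS : {x | t < hlMaximal μ g x} = ⋃ N, S N := by
    ext x
    simp only [hlMaximal, lt_iSup_iff, mem_ofPred_eq, mem_iUnion, S]
    exact ⟨fun ⟨r, hr⟩ => ⟨⌈r⌉₊, r, Nat.le_ceil r, hr⟩, fun ⟨_, r, _, hr⟩ => ⟨r, hr⟩⟩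
  have hmono : Monotone S := fun M N h x ⟨r, hrM, hr⟩ => ⟨r, hrM.trans (by exact_mod_cast h), hr⟩
  rw [hS, hmono.measure_iUnion, ENNReal.mul_iSup]
  exact iSup_le fun N => mul_measure_le_of_forall_lt_setLAverage μ g t fun x hx => hx

theorem measure_lt_hlMaximal_le {g : E → ℝ≥0∞} (hg : Measurable g) {t : ℝ≥0∞} (ht0 : t ≠ 0)
    (ht : t ≠ ∞) :
    μ {x | t < hlMaximal μ g x} ≤
      2 * 5 ^ finrank ℝ E * (t⁻¹ * ∫⁻ x in {x | t < 2 * g x}, g x ∂μ) := by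
  set g' : E → ℝ≥0∞ := {y | t / 2 < g y}.indicator g
  have hsub : {x | t < hlMaximal μ g x} ⊆ {x | t / 2 < hlMaximal μ g' x} := fun x hx => by
    by_contra! h
    have hlt := (hx : t < _).trans_le (hlMaximal_le_indicator_add μ g (t / 2) x)
    exact (hlt.trans_le (add_le_add_left (not_lt.1 h) _)).ne (ENNReal.add_halves t).symm
  have hg' : ∫⁻ x, g' x ∂μ = ∫⁻ x in {x | t < 2 * g x}, g x ∂μ := by
    rw [lintegral_indicator (measurableSet_lt measurable_const hg)]
    simp only [ENNReal.div_lt_iff (.inl two_ne_zero) (.inl ENNReal.ofNat_ne_top), mul_comm]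
  have hweak := mul_measure_lt_hlMaximal_le μ g' (t / 2)
  rw [hg', mul_comm, ← ENNReal.le_div_iff_mul_le (.inl (ENNReal.half_pos ht0).ne')
    (.inl (ENNReal.div_ne_top ht two_ne_zero))] at hweak
  calc μ {x | t < hlMaximal μ g x}
      ≤ μ {x | t / 2 < hlMaximal μ g' x} := measure_mono hsub
    _ ≤ 5 ^ finrank ℝ E * (∫⁻ x in {x | t < 2 * g x}, g x ∂μ) / (t / 2) := hweak
    _ = 2 * 5 ^ finrank ℝ E * (t⁻¹ * ∫⁻ x in {x | t < 2 * g x}, g x ∂μ) := by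
        rw [div_eq_mul_inv, ENNReal.inv_div (.inl ENNReal.ofNat_ne_top) (.inl two_ne_zero),
          div_eq_mul_inv]
        ring

theorem lintegral_hlMaximal_rpow_le {p : ℝ} (hp : 1 < p) {g : E → ℝ≥0∞} (hg : Measurable g) :
    ∫⁻ x, hlMaximal μ g x ^ p ∂μ ≤
      2 * 5 ^ finrank ℝ E * ENNReal.ofReal p * 2 ^ (p - 1) / ENNReal.ofReal (p - 1) *
        ∫⁻ x, g x ^ p ∂μ := by
  have hp1 : 0 < p - 1 := by linarith
  have hM : Measurable (hlMaximal μ g) :=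
    measurable_hlMaximal μ (F := fun _ => g) (c := id) (hg.comp measurable_snd) measurable_id
  have hweak (t : ℝ) (ht : 0 < t) :
      ENNReal.ofReal t ^ (p - 1) * μ {x | ENNReal.ofReal t < hlMaximal μ g x} ≤
        2 * 5 ^ finrank ℝ E * (ENNReal.ofReal t ^ (p - 1 - 1) *
          μ.withDensity g {x | ENNReal.ofReal t < 2 * g x}) := by
    have ht0 : ENNReal.ofReal t ≠ 0 := (ENNReal.ofReal_pos.2 ht).ne'
    rw [withDensity_apply _ (measurableSet_lt measurable_const (hg.const_mul 2)),
      ENNReal.rpow_sub (p - 1) 1 ht0 ENNReal.ofReal_ne_top, ENNReal.rpow_one]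
    refine (mul_le_mul_right (measure_lt_hlMaximal_le μ hg ht0 ENNReal.ofReal_ne_top) _).trans_eq ?_
    rw [div_eq_mul_inv]
    ring
  have hcake := lintegral_rpow_eq_mul_lintegral_meas_lt (μ.withDensity g) (hg.const_mul 2) hp1
  rw [lintegral_withDensity_eq_lintegral_mul _ hg (by fun_prop), eq_comm,
    ← ENNReal.eq_div_iff (ENNReal.ofReal_pos.2 hp1).ne' ENNReal.ofReal_ne_top] at hcake
  have hpow (x : E) : g x * (2 * g x) ^ (p - 1) = 2 ^ (p - 1) * g x ^ p := by
    rw [ENNReal.mul_rpow_of_nonneg _ _ hp1.le, mul_left_comm]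
    congr 1
    nth_rw 1 [← ENNReal.rpow_one (g x), ← ENNReal.rpow_add_of_nonneg _ _ zero_le_one hp1.le]
    ring_nf
  calc ∫⁻ x, hlMaximal μ g x ^ p ∂μ
      ≤ ENNReal.ofReal p * ∫⁻ t in Ioi (0 : ℝ), 2 * 5 ^ finrank ℝ E *
          (ENNReal.ofReal t ^ (p - 1 - 1) *
            μ.withDensity g {x | ENNReal.ofReal t < 2 * g x}) := by
        rw [lintegral_rpow_eq_mul_lintegral_meas_lt μ hM (by linarith)]
        gcongr ENNReal.ofReal p * ?_
        exact setLIntegral_mono' measurableSet_Ioi hweak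
    _ = ENNReal.ofReal p * (2 * 5 ^ finrank ℝ E *
          ((∫⁻ x, 2 ^ (p - 1) * g x ^ p ∂μ) / ENNReal.ofReal (p - 1))) := by
        rw [lintegral_const_mul' _ _ (by finiteness), hcake]
        simp only [Pi.mul_apply, hpow]
    _ = _ := by
        rw [lintegral_const_mul _ (by fun_prop), div_eq_mul_inv, div_eq_mul_inv]
        ring

end MaximalTheorem

theorem enorm_le_enorm_add_enorm_sub {F : Type*} [SeminormedAddCommGroup F] (a b : F) :
    ‖b‖ₑ ≤ ‖a‖ₑ + ‖a - b‖ₑ := by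
  simpa using enorm_sub_le (a := a) (b := a - b)

theorem enorm_sub_le_enorm_sub_add_enorm_sub {F : Type*} [SeminormedAddCommGroup F] (a b c : F) :
    ‖a - b‖ₑ ≤ ‖a - c‖ₑ + ‖b - c‖ₑ := by
  simpa using enorm_sub_le (a := a - c) (b := b - c)

theorem setLAverage_enorm_le_enorm_add {α F : Type*} [MeasurableSpace α]
    [SeminormedAddCommGroup F] (μ : Measure α) {s : Set α} (hs₀ : μ s ≠ 0) (hs : μ s ≠ ∞)
    (f : α → F) (a : F) :
    ⨍⁻ w in s, ‖f w‖ₑ ∂μ ≤ ‖a‖ₑ + ⨍⁻ w in s, ‖a - f w‖ₑ ∂μ :=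
  calc ⨍⁻ w in s, ‖f w‖ₑ ∂μ ≤ ⨍⁻ w in s, (‖a‖ₑ + ‖a - f w‖ₑ) ∂μ :=
        laverage_mono_ae (ae_of_all _ fun w => enorm_le_enorm_add_enorm_sub _ _)
    _ = ⨍⁻ _ in s, ‖a‖ₑ ∂μ + ⨍⁻ w in s, ‖a - f w‖ₑ ∂μ :=
        lintegral_add_left measurable_const _
    _ = ‖a‖ₑ + ⨍⁻ w in s, ‖a - f w‖ₑ ∂μ := by rw [setLAverage_const hs₀ hs]

section Rescaling

variable {E : Type*} [NormedAddCommGroup E] [NormedSpace ℝ E] [FiniteDimensional ℝ E]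
  [MeasurableSpace E] [BorelSpace E] (μ : Measure E) [μ.IsAddHaarMeasure]

theorem lintegral_comp_add_smul (g : E → ℝ≥0∞) (x : E) {r : ℝ} (hr : 0 < r) :
    ∫⁻ z, g (x + r • z) ∂μ = (ENNReal.ofReal r ^ finrank ℝ E)⁻¹ * ∫⁻ z, g z ∂μ := by
  have he : MeasurableEmbedding fun z : E => r • z :=
    (Homeomorph.smulOfNeZero r hr.ne').measurableEmbedding
  rw [← he.lintegral_map (μ := μ) fun z => g (x + z), Measure.map_addHaar_smul μ hr.ne',
    lintegral_smul_measure, lintegral_add_left_eq_self g x, smul_eq_mul, abs_of_pos (by positivity),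
    ENNReal.ofReal_inv_of_pos (by positivity), ENNReal.ofReal_pow hr.le]

theorem add_smul_mem_ball_iff {E : Type*} [SeminormedAddCommGroup E] [NormedSpace ℝ E] {x z : E}
    {r s : ℝ} (hr : 0 < r) : x + r • z ∈ ball x (r * s) ↔ z ∈ ball 0 s := by
  simp [mem_ball, dist_eq_norm, norm_smul, abs_of_pos hr, hr]

theorem setLIntegral_ball_comp_add_smul (g : E → ℝ≥0∞) (x : E) {r : ℝ} (hr : 0 < r) (s : ℝ) :
    ∫⁻ z in ball (0 : E) s, g (x + r • z) ∂μ =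
      (ENNReal.ofReal r ^ finrank ℝ E)⁻¹ * ∫⁻ y in ball x (r * s), g y ∂μ := by
  rw [← lintegral_indicator measurableSet_ball, ← lintegral_indicator measurableSet_ball,
    ← lintegral_comp_add_smul μ _ x hr]
  refine lintegral_congr fun z => ?_
  by_cases hz : z ∈ ball 0 s <;> simp [hz, add_smul_mem_ball_iff hr]

theorem addHaar_ball_two_mul (x : E) {r : ℝ} (hr : 0 < r) :
    μ (ball x (2 * r)) = 2 ^ finrank ℝ E * μ (ball x r) := by
  rw [Measure.addHaar_ball_of_pos _ _ (by positivity), Measure.addHaar_ball_of_pos _ _ hr, mul_pow,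
    ENNReal.ofReal_mul (by positivity), mul_assoc, ENNReal.ofReal_pow (by norm_num),
    ENNReal.ofReal_ofNat]

theorem setLAverage_ball_comp_add_smul (g : E → ℝ≥0∞) (x : E) {r : ℝ} (hr : 0 < r) :
    ⨍⁻ z in ball (0 : E) 1, g (x + r • z) ∂μ = ⨍⁻ y in ball x r, g y ∂μ := by
  have hr0 : ENNReal.ofReal r ^ finrank ℝ E ≠ 0 := pow_ne_zero _ (ENNReal.ofReal_pos.2 hr).ne'
  rw [setLAverage_eq, setLAverage_eq, setLIntegral_ball_comp_add_smul μ g x hr, mul_one,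
    Measure.addHaar_ball_of_pos μ x hr, ENNReal.ofReal_pow hr.le,
    ← ENNReal.mul_div_mul_left (_ * _) (μ (ball 0 1)) hr0 (by finiteness), ← mul_assoc,
    ENNReal.mul_inv_cancel hr0 (by finiteness), one_mul]

end Rescaling

section LocalOscillation

/-- The local oscillation of `f` in `G` at scale `t`: up to a constant factor, the mean of
`|f u - f w|` over `w ∈ B(u, 2t) ∩ G`. Normalizing by the measure of `B(u, t)` makes it dominate
the mean over every ball of radius `t` contained in `B(u, 2t) ∩ G`. -/
noncomputable def localOscillation {X F : Type*} [PseudoMetricSpace X] [MeasurableSpace X]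
    [SeminormedAddCommGroup F] (μ : Measure X) (G : Set X) (f : X → F) (t : ℝ) : X → ℝ≥0∞ :=
  G.indicator fun u => (μ (ball u t))⁻¹ * ∫⁻ w in ball u (2 * t) ∩ G, ‖f u - f w‖ₑ ∂μ

theorem measurable_enorm_sub {X F : Type*} [MeasurableSpace X] [SeminormedAddCommGroup F]
    {f : X → F} (hf : StronglyMeasurable f) : Measurable fun q : X × X => ‖f q.1 - f q.2‖ₑ :=
  ((hf.comp_measurable measurable_fst).sub (hf.comp_measurable measurable_snd)).enorm

theorem measurable_localOscillation {X F : Type*} [PseudoMetricSpace X] [MeasurableSpace X]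
    [OpensMeasurableSpace X] [SecondCountableTopology X] [SeminormedAddCommGroup F] (μ : Measure X)
    [SFinite μ] {G : Set X} (hG : MeasurableSet G) {f : X → F} (hf : StronglyMeasurable f) :
    Measurable (Function.uncurry (localOscillation μ G f)) := by
  have hball : Measurable fun q : ℝ × X => μ (ball q.2 q.1) := by
    simpa only [setLIntegral_one] using measurable_setLIntegral_ball μ (F := fun _ _ => 1)
      measurable_const measurable_snd measurable_fst
  have hint : Measurable fun q : ℝ × X => ∫⁻ w in ball q.2 (2 * q.1) ∩ G, ‖f q.2 - f w‖ₑ ∂μ := by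
    simp only [← Measure.restrict_restrict measurableSet_ball]
    exact measurable_setLIntegral_ball _ (α := ℝ × X) (F := fun q w => ‖f q.2 - f w‖ₑ)
      ((measurable_enorm_sub hf).comp (measurable_fst.snd.prodMk measurable_snd))
      measurable_snd (measurable_fst.const_mul 2)
  exact (hball.inv.mul hint).indicator (measurable_snd hG)

variable {E F : Type*} [NormedAddCommGroup E] [MeasurableSpace E] [BorelSpace E]
  [SeminormedAddCommGroup F] (μ : Measure E) [μ.IsAddHaarMeasure] {G : Set E} {f : E → F}

theorem setLAverage_enorm_sub_le_localOscillation {c u : E} {t : ℝ} (hc : ball c t ⊆ G)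
    (hu : u ∈ G) (hcu : dist c u ≤ t) :
    ⨍⁻ w in ball c t, ‖f u - f w‖ₑ ∂μ ≤ localOscillation μ G f t u := by
  have hsub : ball c t ⊆ ball u (2 * t) ∩ G :=
    subset_inter (ball_subset_ball' (by linarith)) hc
  rw [localOscillation, indicator_of_mem hu, setLAverage_eq, Measure.addHaar_ball_center,
    ← Measure.addHaar_ball_center μ u, ENNReal.div_eq_inv_mul]
  gcongr

theorem setLAverage_le_enorm_add_localOscillation [ProperSpace E] {x y : E} {r : ℝ} (hr : 0 < r)
    (hx : ball x r ⊆ G) (hy : y ∈ G) (hxy : dist x y ≤ r) :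
    ⨍⁻ w in ball x r, ‖f w‖ₑ ∂μ ≤ ‖f y‖ₑ + localOscillation μ G f r y :=
  (setLAverage_enorm_le_enorm_add μ (measure_ball_pos μ x hr).ne' measure_ball_lt_top.ne f
    (f y)).trans (add_le_add_right (setLAverage_enorm_sub_le_localOscillation μ hx hy hxy) _)

theorem enorm_sub_le_localOscillation_add [ProperSpace E] (hf : StronglyMeasurable f) {c u v : E}
    {t : ℝ} (ht : 0 < t) (hc : ball c t ⊆ G) (hu : u ∈ G) (hv : v ∈ G) (hcu : dist c u ≤ t)
    (hcv : dist c v ≤ t) :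
    ‖f u - f v‖ₑ ≤ localOscillation μ G f t u + localOscillation μ G f t v := by
  calc ‖f u - f v‖ₑ = ⨍⁻ _ in ball c t, ‖f u - f v‖ₑ ∂μ :=
        (setLAverage_const (measure_ball_pos μ c ht).ne' measure_ball_lt_top.ne _).symm
    _ ≤ ⨍⁻ w in ball c t, (‖f u - f w‖ₑ + ‖f v - f w‖ₑ) ∂μ :=
        laverage_mono_ae (ae_of_all _ fun w => enorm_sub_le_enorm_sub_add_enorm_sub _ _ _)
    _ = ⨍⁻ w in ball c t, ‖f u - f w‖ₑ ∂μ + ⨍⁻ w in ball c t, ‖f v - f w‖ₑ ∂μ :=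
        lintegral_add_left (stronglyMeasurable_const.sub hf).enorm _
    _ ≤ localOscillation μ G f t u + localOscillation μ G f t v :=
        add_le_add (setLAverage_enorm_sub_le_localOscillation μ hc hu hcu)
          (setLAverage_enorm_sub_le_localOscillation μ hc hv hcv)

variable [NormedSpace ℝ E] [FiniteDimensional ℝ E]

theorem enorm_add_smul_le_add_localOscillation (hf : StronglyMeasurable f) {x y z : E} {r ρ : ℝ}
    (hρ : 0 < ρ) (hρr : ρ < r) (hx : ball x r ⊆ G) (hxy : dist x y ≤ ρ) (hz : z ∈ ball 0 1) :
    ‖f (x + r • z)‖ₑ ≤ ‖f (y + (r - ρ) • z)‖ₑ + (localOscillation μ G f ρ (x + r • z) +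
      localOscillation μ G f ρ (y + (r - ρ) • z)) := by
  set c := x + (r - ρ) • z with hc
  have hux : x + r • z ∈ ball x r := by
    simpa using (add_smul_mem_ball_iff (x := x) (hρ.trans hρr)).2 hz
  have hcx : dist c x < r - ρ := by
    simpa [hc] using (add_smul_mem_ball_iff (x := x) (sub_pos.2 hρr)).2 hz
  have hcu : dist c (x + r • z) ≤ ρ := by
    rw [hc, dist_add_left, dist_eq_norm, ← sub_smul, norm_smul, sub_sub_cancel_left, norm_neg,
      Real.norm_of_nonneg hρ.le]
    exact mul_le_of_le_one_right hρ.le (mem_ball_zero_iff.1 hz).le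
  have hcv : dist (y + (r - ρ) • z) c ≤ ρ := by rwa [hc, dist_add_right, dist_comm]
  have hvx : y + (r - ρ) • z ∈ ball x r :=
    mem_ball.2 (by linarith [dist_triangle (y + (r - ρ) • z) c x])
  have hball : ball c ρ ⊆ G := (ball_subset_ball' (by linarith)).trans hx
  calc ‖f (x + r • z)‖ₑ
      ≤ ‖f (y + (r - ρ) • z)‖ₑ + ‖f (y + (r - ρ) • z) - f (x + r • z)‖ₑ :=
        enorm_le_enorm_add_enorm_sub _ _
    _ ≤ _ := by
        rw [enorm_sub_rev]
        gcongr
        exact enorm_sub_le_localOscillation_add μ hf hρ hball (hx hux) (hx hvx) hcu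
          (dist_comm c _ ▸ hcv)

theorem setLAverage_le_setLAverage_add_hlMaximal (hG : MeasurableSet G) (hf : StronglyMeasurable f)
    {x y : E} {r ρ : ℝ} (hρ : 0 < ρ) (hρr : ρ < r) (hx : ball x r ⊆ G) (hxy : dist x y ≤ ρ) :
    ⨍⁻ w in ball x r, ‖f w‖ₑ ∂μ ≤ ⨍⁻ w in ball y (r - ρ), ‖f w‖ₑ ∂μ +
      (hlMaximal μ (localOscillation μ G f ρ) x + hlMaximal μ (localOscillation μ G f ρ) y) := by
  set osc := localOscillation μ G f ρ
  have hosc : Measurable osc := (measurable_localOscillation μ hG hf).of_uncurry_left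
  have hu : Measurable fun z => osc (x + r • z) := hosc.comp (by fun_prop)
  have hv : Measurable fun z => ‖f (y + (r - ρ) • z)‖ₑ := hf.enorm.comp (by fun_prop)
  have hrρ : 0 < r - ρ := sub_pos.2 hρr
  rw [← setLAverage_ball_comp_add_smul μ _ x (hρ.trans hρr)]
  calc ⨍⁻ z in ball 0 1, ‖f (x + r • z)‖ₑ ∂μ
      ≤ ⨍⁻ z in ball 0 1, (‖f (y + (r - ρ) • z)‖ₑ +
          (osc (x + r • z) + osc (y + (r - ρ) • z))) ∂μ :=
        laverage_mono_ae <| ae_restrict_of_forall_mem measurableSet_ball fun z hz =>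
          enorm_add_smul_le_add_localOscillation μ hf hρ hρr hx hxy hz
    _ = ⨍⁻ z in ball 0 1, ‖f (y + (r - ρ) • z)‖ₑ ∂μ + (⨍⁻ z in ball 0 1, osc (x + r • z) ∂μ +
          ⨍⁻ z in ball 0 1, osc (y + (r - ρ) • z) ∂μ) := by
        simp only [laverage]
        rw [lintegral_add_left hv, lintegral_add_left hu]
    _ ≤ _ := by
        rw [setLAverage_ball_comp_add_smul μ (‖f ·‖ₑ) y hrρ,
          setLAverage_ball_comp_add_smul μ osc y hrρ,
          setLAverage_ball_comp_add_smul μ osc x (hρ.trans hρr)]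
        gcongr <;> exact setLAverage_ball_le_hlMaximal μ _ _ _

theorem localOscillation_le_of_le {t₀ t : ℝ} (ht₀ : 0 < t₀) (h : t₀ ≤ t) (h' : t ≤ 2 * t₀) (u : E) :
    localOscillation μ G f t₀ u ≤ 2 ^ finrank ℝ E * localOscillation μ G f t u := by
  have hμ : (μ (ball u t₀))⁻¹ ≤ 2 ^ finrank ℝ E * (μ (ball u t))⁻¹ := by
    have hle : μ (ball u t) ≤ 2 ^ finrank ℝ E * μ (ball u t₀) := by
      rw [← addHaar_ball_two_mul μ u ht₀]
      exact measure_mono (ball_subset_ball h')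
    have hpos : μ (ball u t) ≠ 0 := (measure_ball_pos μ u (ht₀.trans_le h)).ne'
    rw [← div_eq_mul_inv, ENNReal.le_div_iff_mul_le (.inl hpos) (.inl measure_ball_lt_top.ne),
      mul_comm, ← div_eq_mul_inv]
    exact ENNReal.div_le_of_le_mul hle
  by_cases hu : u ∈ G
  · simp only [localOscillation, indicator_of_mem hu]
    rw [← mul_assoc]
    gcongr
  · simp [localOscillation, hu]

theorem localOscillation_rpow_le {p : ℝ} (hp : 1 < p) (hf : StronglyMeasurable f) {t : ℝ}
    (ht : 0 < t) {u : E} (hu : u ∈ G) :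
    localOscillation μ G f t u ^ p ≤ (2 ^ finrank ℝ E) ^ (p - 1) * (μ (ball u t))⁻¹ *
      ∫⁻ w in ball u (2 * t) ∩ G, ‖f u - f w‖ₑ ^ p ∂μ := by
  have hp0 : 0 < p - 1 := sub_pos.2 hp
  have hb0 : μ (ball u t) ≠ 0 := (measure_ball_pos μ u ht).ne'
  have hb : μ (ball u t) ≠ ∞ := measure_ball_lt_top.ne
  have hs : μ (ball u (2 * t) ∩ G) ≤ 2 ^ finrank ℝ E * μ (ball u t) :=
    (measure_mono inter_subset_left).trans_eq (addHaar_ball_two_mul μ u ht)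
  have hcancel : (μ (ball u t))⁻¹ ^ p * μ (ball u t) ^ (p - 1) = (μ (ball u t))⁻¹ := by
    rw [ENNReal.inv_rpow, ← ENNReal.rpow_neg, ← ENNReal.rpow_add _ _ hb0 hb, neg_add_eq_sub,
      sub_sub_cancel_left, ENNReal.rpow_neg_one]
  rw [localOscillation, indicator_of_mem hu, ENNReal.mul_rpow_of_nonneg _ _ (by linarith)]
  calc (μ (ball u t))⁻¹ ^ p * (∫⁻ w in ball u (2 * t) ∩ G, ‖f u - f w‖ₑ ∂μ) ^ p
      ≤ (μ (ball u t))⁻¹ ^ p * ((2 ^ finrank ℝ E * μ (ball u t)) ^ (p - 1) *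
          ∫⁻ w in ball u (2 * t) ∩ G, ‖f u - f w‖ₑ ^ p ∂μ) := by
        gcongr
        refine (rpow_setLIntegral_le hp (g := fun w => ‖f u - f w‖ₑ)
          (stronglyMeasurable_const.sub hf).enorm.aemeasurable _).trans ?_
        gcongr
    _ = (2 ^ finrank ℝ E) ^ (p - 1) *
          ((μ (ball u t))⁻¹ ^ p * μ (ball u t) ^ (p - 1)) *
          ∫⁻ w in ball u (2 * t) ∩ G, ‖f u - f w‖ₑ ^ p ∂μ := by
        rw [ENNReal.mul_rpow_of_nonneg _ _ hp0.le]
        ring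
    _ = _ := by rw [hcancel]

end LocalOscillation

section GagliardoEnergy

/-- The Gagliardo energy `∬_{G × G} |f u - f w|^p / |u - w|^α`. For `α = n + s p` this is the `p`-th
power of the seminorm of `W^{s,p}(G)`. -/
noncomputable def gagliardoEnergy {E F : Type*} [NormedAddCommGroup E] [MeasurableSpace E]
    [SeminormedAddCommGroup F] (μ : Measure E) (G : Set E) (f : E → F) (p α : ℝ) : ℝ≥0∞ :=
  ∫⁻ u in G, ∫⁻ w in G, ‖f u - f w‖ₑ ^ p / ‖u - w‖ₑ ^ α ∂μ ∂μ

/-- The Hölder quotient `|f y - f x| / |y - x|^γ`, extended by zero outside `G × G`. -/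
noncomputable def diffQuotient {E F : Type*} [SeminormedAddCommGroup E] [SeminormedAddCommGroup F]
    (G : Set E) (f : E → F) (γ : ℝ) (y x : E) : ℝ≥0∞ :=
  (G ×ˢ G).indicator (fun q => ‖f q.1 - f q.2‖ₑ / ‖q.1 - q.2‖ₑ ^ γ) (y, x)

theorem enorm_sub_le_rpow_mul_diffQuotient {E F : Type*} [NormedAddCommGroup E]
    [SeminormedAddCommGroup F] {G : Set E} (f : E → F) {γ : ℝ} (hγ : 0 ≤ γ) {x y : E} (hx : x ∈ G)
    (hy : y ∈ G) : ‖f y - f x‖ₑ ≤ ‖y - x‖ₑ ^ γ * diffQuotient G f γ y x := by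
  rcases eq_or_ne y x with rfl | h
  · rw [sub_self, ← ofReal_norm, norm_zero, ENNReal.ofReal_zero]
    exact zero_le
  have h0 : ‖y - x‖ₑ ^ γ ≠ 0 := by simp [sub_eq_zero, h]
  rw [diffQuotient, indicator_of_mem (mk_mem_prod hy hx), ENNReal.mul_div_cancel h0 (by finiteness)]

variable {E F : Type*} [NormedAddCommGroup E] [MeasurableSpace E] [SeminormedAddCommGroup F]
  (μ : Measure E) {G : Set E} {f : E → F}

theorem lintegral_diffQuotient_rpow (hG : MeasurableSet G) {p : ℝ} (hp : 0 < p) (α : ℝ) :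
    ∫⁻ y, ∫⁻ x, diffQuotient G f (α / p) y x ^ p ∂μ ∂μ = gagliardoEnergy μ G f p α := by
  rw [gagliardoEnergy, ← lintegral_indicator hG]
  refine lintegral_congr fun y => ?_
  by_cases hy : y ∈ G
  · rw [indicator_of_mem hy, ← lintegral_indicator hG]
    refine lintegral_congr fun x => ?_
    by_cases hx : x ∈ G
    · rw [diffQuotient, indicator_of_mem (mk_mem_prod hy hx), indicator_of_mem hx,
        ENNReal.div_rpow_of_nonneg _ _ hp.le, ← ENNReal.rpow_mul, div_mul_cancel₀ _ hp.ne']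
    · simp [diffQuotient, hx, hp]
  · simp [diffQuotient, hy, hp]

variable [BorelSpace E]

theorem measurable_diffQuotient [SecondCountableTopology E] (hG : MeasurableSet G)
    (hf : StronglyMeasurable f) (γ : ℝ) : Measurable (Function.uncurry (diffQuotient G f γ)) :=
  ((measurable_enorm_sub hf).div (by fun_prop)).indicator (hG.prod hG)

theorem setLAverage_le_enorm_add_rpow_mul_hlMaximal [ProperSpace E] [μ.IsAddHaarMeasure]
    (f : E → F) {γ : ℝ} (hγ : 0 ≤ γ) {x y : E} {r : ℝ} (hr : 0 < r) (hrxy : r ≤ dist x y)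
    (hx : ball x r ⊆ G) (hy : y ∈ G) :
    ⨍⁻ w in ball x r, ‖f w‖ₑ ∂μ ≤
      ‖f y‖ₑ + (2 * ‖x - y‖ₑ) ^ γ * hlMaximal μ (diffQuotient G f γ y) x := by
  have hdist {w : E} (hw : w ∈ ball x r) : ‖y - w‖ₑ ≤ 2 * ‖x - y‖ₑ := by
    rw [← edist_eq_enorm_sub, ← edist_eq_enorm_sub, two_mul]
    refine (edist_triangle y x w).trans (add_le_add (edist_comm y x).le ?_)
    rw [edist_dist, edist_dist, dist_comm]
    exact ENNReal.ofReal_le_ofReal ((mem_ball.1 hw).le.trans hrxy)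
  calc ⨍⁻ w in ball x r, ‖f w‖ₑ ∂μ
      ≤ ‖f y‖ₑ + ⨍⁻ w in ball x r, ‖f y - f w‖ₑ ∂μ :=
        setLAverage_enorm_le_enorm_add μ (measure_ball_pos μ x hr).ne' measure_ball_lt_top.ne f _
    _ ≤ ‖f y‖ₑ + ⨍⁻ w in ball x r, (2 * ‖x - y‖ₑ) ^ γ * diffQuotient G f γ y w ∂μ := by
        refine add_le_add_right (laverage_mono_ae <|
          ae_restrict_of_forall_mem measurableSet_ball fun w hw => ?_) _
        refine (enorm_sub_le_rpow_mul_diffQuotient f hγ (hx hw) hy).trans ?_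
        gcongr
        exact hdist hw
    _ = ‖f y‖ₑ + (2 * ‖x - y‖ₑ) ^ γ * ⨍⁻ w in ball x r, diffQuotient G f γ y w ∂μ := by
        rw [laverage, laverage, lintegral_const_mul' _ _ (by finiteness)]
    _ ≤ _ := by
        gcongr
        exact setLAverage_ball_le_hlMaximal μ _ _ _

end GagliardoEnergy

section MaximalEnergy

/-- The density `|g|^p + |Mg|^p`, where `M` is the Hardy–Littlewood maximal operator; both terms
are controlled by `∫ |g|^p` when `p > 1`. -/
noncomputable def maximalEnergy {X : Type*} [PseudoMetricSpace X] [MeasurableSpace X]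
    (μ : Measure X) (p : ℝ) (g : X → ℝ≥0∞) (x : X) : ℝ≥0∞ :=
  g x ^ p + hlMaximal μ g x ^ p

theorem measurable_maximalEnergy {X α : Type*} [PseudoMetricSpace X] [MeasurableSpace X]
    [OpensMeasurableSpace X] [SecondCountableTopology X] [MeasurableSpace α] (μ : Measure X)
    [SFinite μ] (p : ℝ) {g : α → X → ℝ≥0∞} (hg : Measurable (Function.uncurry g)) {c : α → X}
    (hc : Measurable c) : Measurable fun a => maximalEnergy μ p (g a) (c a) :=
  ((hg.comp (measurable_id.prodMk hc)).pow_const p).add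
    ((measurable_hlMaximal μ hg hc).pow_const p)

theorem maximalEnergy_le_of_le_const_mul {X : Type*} [PseudoMetricSpace X] [MeasurableSpace X]
    (μ : Measure X) {p : ℝ} (hp : 0 ≤ p) {c : ℝ≥0∞} (hc : c ≠ ∞) {g h : X → ℝ≥0∞}
    (hgh : ∀ x, g x ≤ c * h x) (x : X) : maximalEnergy μ p g x ≤ c ^ p * maximalEnergy μ p h x := by
  have hM : hlMaximal μ g x ≤ c * hlMaximal μ h x := by
    refine iSup_le fun r => (laverage_mono_ae (ae_of_all _ hgh)).trans ?_
    rw [laverage, lintegral_const_mul' _ _ hc]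
    gcongr
    exact setLAverage_ball_le_hlMaximal μ h x r
  rw [maximalEnergy, maximalEnergy, mul_add, ← ENNReal.mul_rpow_of_nonneg _ _ hp,
    ← ENNReal.mul_rpow_of_nonneg _ _ hp]
  gcongr
  exact hgh x

theorem exists_lintegral_maximalEnergy_le {E : Type*} [NormedAddCommGroup E] [NormedSpace ℝ E]
    [FiniteDimensional ℝ E] [MeasurableSpace E] [BorelSpace E] (μ : Measure E)
    [μ.IsAddHaarMeasure] {p : ℝ} (hp : 1 < p) :
    ∃ C : ℝ≥0∞, C ≠ ∞ ∧ ∀ g : E → ℝ≥0∞, Measurable g →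
      ∫⁻ x, maximalEnergy μ p g x ∂μ ≤ C * ∫⁻ x, g x ^ p ∂μ := by
  have hp1 : ENNReal.ofReal (p - 1) ≠ 0 := (ENNReal.ofReal_pos.2 (sub_pos.2 hp)).ne'
  refine ⟨1 + 2 * 5 ^ finrank ℝ E * ENNReal.ofReal p * 2 ^ (p - 1) / ENNReal.ofReal (p - 1),
    by finiteness, fun g hg => ?_⟩
  rw [add_mul, one_mul]
  simp only [maximalEnergy]
  rw [lintegral_add_left (hg.pow_const p)]
  gcongr
  exact lintegral_hlMaximal_rpow_le μ hp hg

end MaximalEnergy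

theorem setLIntegral_Ioi_mul_setLIntegral_ball {X : Type*} [PseudoMetricSpace X]
    [MeasurableSpace X] [OpensMeasurableSpace X] (μ : Measure X) [SFinite μ] {h : ℝ → ℝ≥0∞}
    (hh : Measurable h) {k : X → ℝ≥0∞} (hk : Measurable k) (x : X) {c : ℝ} (hc : 0 < c) :
    ∫⁻ t in Ioi (0 : ℝ), h t * (∫⁻ y in ball x (c * t), k y ∂μ) =
      ∫⁻ y, k y * (∫⁻ t in Ioi (dist x y / c), h t) ∂μ := by
  have hmem (t : ℝ) (y : X) : y ∈ ball x (c * t) ↔ t ∈ Ioi (dist x y / c) := by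
    rw [mem_ball', mem_Ioi, div_lt_iff₀' hc]
  have hmeas : Measurable (Function.uncurry fun (t : ℝ) (y : X) =>
      (ball x (c * t)).indicator (fun y => h t * k y) y) :=
    ((hh.comp measurable_fst).mul (hk.comp measurable_snd)).indicator
      (s := {q : ℝ × X | dist q.2 x < c * q.1})
      (measurableSet_lt (((continuous_id.dist continuous_const).measurable).comp measurable_snd)
        (by fun_prop))
  calc ∫⁻ t in Ioi (0 : ℝ), h t * (∫⁻ y in ball x (c * t), k y ∂μ)
      = ∫⁻ t in Ioi (0 : ℝ), (∫⁻ y, (ball x (c * t)).indicator (fun y => h t * k y) y ∂μ) := by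
        simp only [lintegral_indicator measurableSet_ball, lintegral_const_mul _ hk]
    _ = ∫⁻ y, (∫⁻ t in Ioi (0 : ℝ), (ball x (c * t)).indicator (fun y => h t * k y) y) ∂μ :=
        lintegral_lintegral_swap hmeas.aemeasurable
    _ = ∫⁻ y, k y * (∫⁻ t in Ioi (dist x y / c), h t) ∂μ := by
        refine lintegral_congr fun y => ?_
        have hind (t : ℝ) : (ball x (c * t)).indicator (fun y => h t * k y) y =
            (Ioi (dist x y / c)).indicator (fun t => k y * h t) t := by
          simp only [indicator, hmem, mul_comm]
        simp only [hind]
        rw [setLIntegral_indicator measurableSet_Ioi,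
          inter_eq_self_of_subset_left (Ioi_subset_Ioi (by positivity)), lintegral_const_mul _ hh]

section Kernel

variable {E : Type*} [NormedAddCommGroup E] [NormedSpace ℝ E] [FiniteDimensional ℝ E]
  [MeasurableSpace E] [BorelSpace E] (μ : Measure E) [μ.IsAddHaarMeasure]

theorem setLIntegral_ball_enorm_rpow_ne_top [Nontrivial E] {ε : ℝ} (hε : 0 < ε) :
    ∫⁻ z in ball (0 : E) 1, ‖z‖ₑ ^ (ε - finrank ℝ E) ∂μ ≠ ∞ := by
  have hint : IntegrableOn (fun z : E => ‖z‖ ^ (ε - finrank ℝ E)) (ball 0 1) μ :=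
    integrableOn_ball_of_norm_le_rpow (C := 1) (α := finrank ℝ E - ε) finrank_pos (by linarith)
      (ae_of_all _ fun z => by rw [Real.norm_of_nonneg (by positivity), neg_sub, one_mul])
      (measurable_norm.pow_const _).aestronglyMeasurable
  have hae : ∀ᵐ z ∂μ.restrict (ball 0 1),
      ‖z‖ₑ ^ (ε - finrank ℝ E) = ‖‖z‖ ^ (ε - finrank ℝ E)‖ₑ := by
    filter_upwards [ae_restrict_of_ae (Measure.ae_ne μ 0)] with z hz
    rw [Real.enorm_of_nonneg (by positivity), ← ENNReal.ofReal_rpow_of_pos (norm_pos_iff.2 hz),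
      ofReal_norm]
  rw [lintegral_congr_ae hae]
  exact hint.hasFiniteIntegral.ne

theorem setLIntegral_ball_enorm_sub_rpow (ε : ℝ) (x : E) {t : ℝ} (ht : 0 < t) :
    ∫⁻ y in ball x t, ‖x - y‖ₑ ^ (ε - finrank ℝ E) ∂μ =
      (∫⁻ z in ball (0 : E) 1, ‖z‖ₑ ^ (ε - finrank ℝ E) ∂μ) * ENNReal.ofReal t ^ ε := by
  have ht0 : ENNReal.ofReal t ≠ 0 := (ENNReal.ofReal_pos.2 ht).ne'
  have htd : ENNReal.ofReal t ^ finrank ℝ E ≠ 0 := pow_ne_zero _ ht0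
  have hscale := setLIntegral_ball_comp_add_smul μ (fun y => ‖x - y‖ₑ ^ (ε - finrank ℝ E)) x ht 1
  have hnorm (z : E) : ‖x - (x + t • z)‖ₑ ^ (ε - finrank ℝ E) =
      ENNReal.ofReal t ^ (ε - finrank ℝ E) * ‖z‖ₑ ^ (ε - finrank ℝ E) := by
    rw [sub_add_cancel_left, enorm_neg, enorm_smul, Real.enorm_of_nonneg ht.le,
      ENNReal.mul_rpow_of_ne_top ENNReal.ofReal_ne_top enorm_ne_top]
  simp only [hnorm, mul_one] at hscale
  rw [lintegral_const_mul' _ _ (by finiteness), ENNReal.rpow_sub _ _ ht0 ENNReal.ofReal_ne_top,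
    ENNReal.rpow_natCast, ENNReal.div_eq_inv_mul, mul_assoc,
    ENNReal.mul_right_inj (ENNReal.inv_ne_zero.2 (by finiteness)) (ENNReal.inv_ne_top.2 htd)]
    at hscale
  rw [← hscale, mul_comm]

theorem lintegral_enorm_sub_rpow_mul_setLIntegral_Ioi (ε : ℝ) (x : E) {h : ℝ → ℝ≥0∞}
    (hh : Measurable h) :
    ∫⁻ y, ‖x - y‖ₑ ^ (ε - finrank ℝ E) * (∫⁻ t in Ioi ‖x - y‖, h t) ∂μ =
      (∫⁻ z in ball (0 : E) 1, ‖z‖ₑ ^ (ε - finrank ℝ E) ∂μ) *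
        ∫⁻ t in Ioi (0 : ℝ), ENNReal.ofReal t ^ ε * h t := by
  have hswap := setLIntegral_Ioi_mul_setLIntegral_ball μ hh
    (k := fun y => ‖x - y‖ₑ ^ (ε - finrank ℝ E)) (by fun_prop) x one_pos
  simp only [one_mul, div_one, dist_eq_norm] at hswap
  rw [← hswap, ← lintegral_const_mul _ (by fun_prop)]
  refine setLIntegral_congr_fun measurableSet_Ioi fun t (ht : 0 < t) => ?_
  rw [setLIntegral_ball_enorm_sub_rpow μ ε x ht, mul_left_comm, mul_comm (h t)]

end Kernel

section OscillationEnergy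

theorem enorm_rpow_mul_setLIntegral_Ioi_le {E F : Type*} [NormedAddCommGroup E]
    [SeminormedAddCommGroup F] (f : E → F) {p α : ℝ} (hp : 0 < p) (hα : 0 < α) (u w : E) :
    ‖f u - f w‖ₑ ^ p * (∫⁻ t in Ioi (dist u w / 2), ENNReal.ofReal t ^ (-(α + 1))) ≤
      2 ^ α / ENNReal.ofReal α * (‖f u - f w‖ₑ ^ p / ‖u - w‖ₑ ^ α) := by
  rcases eq_or_ne u w with rfl | h
  · rw [sub_self, ← ofReal_norm, norm_zero, ENNReal.ofReal_zero, ENNReal.zero_rpow_of_pos hp,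
      zero_mul]
    exact zero_le
  · rw [setLIntegral_Ioi_ofReal_rpow hα (half_pos (dist_pos.2 h)), dist_eq_norm,
      ENNReal.ofReal_div_of_pos two_pos, ofReal_norm, ENNReal.ofReal_ofNat, ENNReal.rpow_neg,
      ENNReal.div_rpow_of_nonneg _ _ hα.le, ENNReal.inv_div (.inl (by finiteness))
      (.inl (by simp))]
    simp only [div_eq_mul_inv]
    exact le_of_eq (by ring)

variable {E F : Type*} [NormedAddCommGroup E] [NormedSpace ℝ E] [FiniteDimensional ℝ E]
  [MeasurableSpace E] [BorelSpace E] [SeminormedAddCommGroup F] (μ : Measure E)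
  [μ.IsAddHaarMeasure] {G : Set E} {f : E → F} {p θ : ℝ}

theorem inv_addHaar_ball (x : E) {t : ℝ} (ht : 0 < t) :
    (μ (ball x t))⁻¹ = (μ (ball (0 : E) 1))⁻¹ * ENNReal.ofReal t ^ (-(finrank ℝ E : ℝ)) := by
  rw [Measure.addHaar_ball_of_pos μ x ht, ENNReal.mul_inv (.inr measure_ball_lt_top.ne)
    (.inl ENNReal.ofReal_ne_top), ENNReal.ofReal_pow ht.le, ENNReal.rpow_neg, ENNReal.rpow_natCast,
    mul_comm]

theorem lintegral_rpow_mul_localOscillation_rpow_le_of_mem (hp : 1 < p)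
    (hθ : 0 < finrank ℝ E + θ) (hf : StronglyMeasurable f) {u : E} (hu : u ∈ G) :
    ∫⁻ t in Ioi (0 : ℝ), ENNReal.ofReal t ^ (-(θ + 1)) * localOscillation μ G f t u ^ p ≤
      (2 ^ finrank ℝ E) ^ (p - 1) * (μ (ball (0 : E) 1))⁻¹ *
          (2 ^ (finrank ℝ E + θ) / ENNReal.ofReal (finrank ℝ E + θ)) *
        ∫⁻ w in G, ‖f u - f w‖ₑ ^ p / ‖u - w‖ₑ ^ (finrank ℝ E + θ) ∂μ := by
  set A : ℝ≥0∞ := (2 ^ finrank ℝ E) ^ (p - 1) * (μ (ball (0 : E) 1))⁻¹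
  set α : ℝ := finrank ℝ E + θ with hα
  have hω : (μ (ball (0 : E) 1))⁻¹ ≠ ∞ := ENNReal.inv_ne_top.2 (measure_ball_pos μ 0 one_pos).ne'
  have hA : A ≠ ∞ := by finiteness
  have hα0 : ENNReal.ofReal α ≠ 0 := (ENNReal.ofReal_pos.2 hθ).ne'
  have hk : Measurable fun w => ‖f u - f w‖ₑ ^ p :=
    (stronglyMeasurable_const.sub hf).enorm.pow_const p
  calc ∫⁻ t in Ioi (0 : ℝ), ENNReal.ofReal t ^ (-(θ + 1)) * localOscillation μ G f t u ^ p
      ≤ ∫⁻ t in Ioi (0 : ℝ), A * (ENNReal.ofReal t ^ (-(α + 1)) *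
          ∫⁻ w in ball u (2 * t), ‖f u - f w‖ₑ ^ p ∂(μ.restrict G)) := by
        refine setLIntegral_mono' measurableSet_Ioi fun t (ht : 0 < t) => ?_
        have ht0 : ENNReal.ofReal t ≠ 0 := (ENNReal.ofReal_pos.2 ht).ne'
        have hrpow : ENNReal.ofReal t ^ (-(α + 1)) =
            ENNReal.ofReal t ^ (-(θ + 1)) * ENNReal.ofReal t ^ (-(finrank ℝ E : ℝ)) := by
          rw [← ENNReal.rpow_add _ _ ht0 ENNReal.ofReal_ne_top, hα]
          congr 1
          ring
        refine (mul_le_mul_right (localOscillation_rpow_le μ hp hf ht hu) _).trans_eq ?_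
        rw [inv_addHaar_ball μ u ht, hrpow, Measure.restrict_restrict measurableSet_ball]
        ring
    _ = A * ∫⁻ w in G, ‖f u - f w‖ₑ ^ p *
          (∫⁻ t in Ioi (dist u w / 2), ENNReal.ofReal t ^ (-(α + 1))) ∂μ := by
        rw [lintegral_const_mul' _ _ hA,
          setLIntegral_Ioi_mul_setLIntegral_ball _ (by fun_prop) hk u two_pos]
    _ ≤ A * ∫⁻ w in G, 2 ^ α / ENNReal.ofReal α * (‖f u - f w‖ₑ ^ p / ‖u - w‖ₑ ^ α) ∂μ :=
        mul_le_mul_right (lintegral_mono fun w =>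
          enorm_rpow_mul_setLIntegral_Ioi_le f (zero_lt_one.trans hp) hθ u w) _
    _ = _ := by rw [lintegral_const_mul' _ _ (by finiteness), mul_assoc A]

theorem lintegral_rpow_mul_lintegral_localOscillation_rpow_le (hp : 1 < p)
    (hθ : 0 < finrank ℝ E + θ) (hG : MeasurableSet G) (hf : StronglyMeasurable f) :
    ∫⁻ t in Ioi (0 : ℝ), ENNReal.ofReal t ^ (-(θ + 1)) *
        (∫⁻ x, localOscillation μ G f t x ^ p ∂μ) ≤
      (2 ^ finrank ℝ E) ^ (p - 1) * (μ (ball (0 : E) 1))⁻¹ *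
          (2 ^ (finrank ℝ E + θ) / ENNReal.ofReal (finrank ℝ E + θ)) *
        gagliardoEnergy μ G f p (finrank ℝ E + θ) := by
  have hω : (μ (ball (0 : E) 1))⁻¹ ≠ ∞ := ENNReal.inv_ne_top.2 (measure_ball_pos μ 0 one_pos).ne'
  have hθ0 : ENNReal.ofReal (finrank ℝ E + θ) ≠ 0 := (ENNReal.ofReal_pos.2 hθ).ne'
  have hosc : Measurable (Function.uncurry fun (t : ℝ) x =>
      ENNReal.ofReal t ^ (-(θ + 1)) * localOscillation μ G f t x ^ p) :=
    ((measurable_fst.ennreal_ofReal).pow_const _).mul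
      ((measurable_localOscillation μ hG hf).pow_const p)
  have hind (x : E) :
      ∫⁻ t in Ioi (0 : ℝ), ENNReal.ofReal t ^ (-(θ + 1)) * localOscillation μ G f t x ^ p =
      G.indicator (fun x => ∫⁻ t in Ioi (0 : ℝ), ENNReal.ofReal t ^ (-(θ + 1)) *
        localOscillation μ G f t x ^ p) x := by
    by_cases hx : x ∈ G
    · rw [indicator_of_mem hx]
    · simp [localOscillation, hx, zero_lt_one.trans hp]
  calc ∫⁻ t in Ioi (0 : ℝ), ENNReal.ofReal t ^ (-(θ + 1)) *
        (∫⁻ x, localOscillation μ G f t x ^ p ∂μ)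
      = ∫⁻ x in G, (∫⁻ t in Ioi (0 : ℝ), ENNReal.ofReal t ^ (-(θ + 1)) *
          localOscillation μ G f t x ^ p) ∂μ := by
        rw [← lintegral_indicator hG, ← lintegral_congr hind,
          ← lintegral_lintegral_swap hosc.aemeasurable]
        refine lintegral_congr fun t => ?_
        rw [lintegral_const_mul _
          ((measurable_localOscillation μ hG hf).of_uncurry_left.pow_const p)]
    _ ≤ ∫⁻ x in G, (2 ^ finrank ℝ E) ^ (p - 1) * (μ (ball (0 : E) 1))⁻¹ *
          (2 ^ (finrank ℝ E + θ) / ENNReal.ofReal (finrank ℝ E + θ)) *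
          (∫⁻ w in G, ‖f x - f w‖ₑ ^ p / ‖x - w‖ₑ ^ (finrank ℝ E + θ) ∂μ) ∂μ :=
        setLIntegral_mono' hG fun x hx =>
          lintegral_rpow_mul_localOscillation_rpow_le_of_mem μ hp hθ hf hx
    _ = _ := by
        rw [lintegral_const_mul' _ _ (by finiteness), gagliardoEnergy]

end OscillationEnergy

section Majorant

theorem measurable_setLIntegral_Ioi {α : Type*} [MeasurableSpace α] {F : α → ℝ → ℝ≥0∞}
    (hF : Measurable (Function.uncurry F)) {c : α → ℝ} (hc : Measurable c) :
    Measurable fun a => ∫⁻ t in Ioi (c a), F a t := by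
  have hind : Measurable fun q : α × ℝ => (Ioi (c q.1)).indicator (F q.1) q.2 :=
    hF.indicator (s := {q : α × ℝ | c q.1 < q.2})
      (measurableSet_lt (hc.comp measurable_fst) measurable_snd)
  simpa only [lintegral_indicator measurableSet_Ioi] using hind.lintegral_prod_right'

/-- The mean oscillations of `f` at all scales `t > t₀`, integrated against the weight
`t ^ (-β) dt / t`. -/
noncomputable def oscillationTail {X F : Type*} [PseudoMetricSpace X] [MeasurableSpace X]
    [SeminormedAddCommGroup F] (μ : Measure X) (G : Set X) (f : X → F) (p β t₀ : ℝ) (x : X) :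
    ℝ≥0∞ :=
  ∫⁻ t in Ioi t₀, ENNReal.ofReal t ^ (-(β + 1)) * maximalEnergy μ p (localOscillation μ G f t) x

/-- The part of `majorant` in which the maximal functions are evaluated at `x`. -/
noncomputable def halfMajorant {E F : Type*} [NormedAddCommGroup E] [NormedSpace ℝ E]
    [MeasurableSpace E] [SeminormedAddCommGroup F] (μ : Measure E) (G : Set E) (f : E → F)
    (p θ ε : ℝ) (x y : E) : ℝ≥0∞ :=
  maximalEnergy μ p (diffQuotient G f ((finrank ℝ E + θ) / p) y) x +
    ‖x - y‖ₑ ^ (ε - finrank ℝ E) * oscillationTail μ G f p (ε + θ) ‖x - y‖ x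

/-- A function on `E × E` whose integral is controlled by the Gagliardo energy of `f` and which
dominates, up to a weight, the `p`-th power of the difference of the means of `|f|` over balls
around `x` and `y`. -/
noncomputable def majorant {E F : Type*} [NormedAddCommGroup E] [NormedSpace ℝ E]
    [MeasurableSpace E] [SeminormedAddCommGroup F] (μ : Measure E) (G : Set E) (f : E → F)
    (p θ ε : ℝ) (x y : E) : ℝ≥0∞ :=
  halfMajorant μ G f p θ ε x y + halfMajorant μ G f p θ ε y x

theorem majorant_comm {E F : Type*} [NormedAddCommGroup E] [NormedSpace ℝ E] [MeasurableSpace E]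
    [SeminormedAddCommGroup F] (μ : Measure E) (G : Set E) (f : E → F) (p θ ε : ℝ) (x y : E) :
    majorant μ G f p θ ε x y = majorant μ G f p θ ε y x :=
  add_comm _ _

theorem measurable_maximalEnergy_localOscillation {X F : Type*} [PseudoMetricSpace X]
    [MeasurableSpace X] [OpensMeasurableSpace X] [SecondCountableTopology X]
    [SeminormedAddCommGroup F] (μ : Measure X) [SFinite μ] {G : Set X} (hG : MeasurableSet G)
    {f : X → F} (hf : StronglyMeasurable f) (p : ℝ) {α : Type*} [MeasurableSpace α] {t : α → ℝ}
    (ht : Measurable t) {c : α → X} (hc : Measurable c) :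
    Measurable fun a => maximalEnergy μ p (localOscillation μ G f (t a)) (c a) := by
  have hosc : Measurable fun q : α × X => localOscillation μ G f (t q.1) q.2 :=
    (measurable_localOscillation μ hG hf).comp ((ht.comp measurable_fst).prodMk measurable_snd)
  exact measurable_maximalEnergy μ p hosc hc

theorem measurable_oscillationTail {X F : Type*} [PseudoMetricSpace X] [MeasurableSpace X]
    [OpensMeasurableSpace X] [SecondCountableTopology X] [SeminormedAddCommGroup F] (μ : Measure X)
    [SFinite μ] {G : Set X} (hG : MeasurableSet G) {f : X → F} (hf : StronglyMeasurable f)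
    (p β : ℝ) : Measurable (Function.uncurry (oscillationTail μ G f p β)) := by
  have hweight : Measurable fun q : (ℝ × X) × ℝ => ENNReal.ofReal q.2 ^ (-(β + 1)) *
      maximalEnergy μ p (localOscillation μ G f q.2) q.1.2 :=
    (measurable_snd.ennreal_ofReal.pow_const _).mul
      (measurable_maximalEnergy_localOscillation μ hG hf p measurable_snd measurable_fst.snd)
  exact measurable_setLIntegral_Ioi hweight measurable_fst

variable {E F : Type*} [NormedAddCommGroup E] [NormedSpace ℝ E] [FiniteDimensional ℝ E]
  [MeasurableSpace E] [BorelSpace E] [SeminormedAddCommGroup F] (μ : Measure E)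
  [μ.IsAddHaarMeasure] {G : Set E} {f : E → F}

theorem measurable_enorm_sub_rpow_mul_oscillationTail (hG : MeasurableSet G)
    (hf : StronglyMeasurable f) (p a β : ℝ) : Measurable (Function.uncurry fun x y : E =>
      ‖x - y‖ₑ ^ a * oscillationTail μ G f p β ‖x - y‖ x) := by
  have hsub : Measurable fun q : E × E => q.1 - q.2 := measurable_fst.sub measurable_snd
  exact (hsub.enorm.pow_const a).mul
    ((measurable_oscillationTail μ hG hf p β).comp (hsub.norm.prodMk measurable_fst))

theorem lintegral_enorm_sub_rpow_mul_oscillationTail (hG : MeasurableSet G)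
    (hf : StronglyMeasurable f) (p θ ε : ℝ) :
    ∫⁻ x, ∫⁻ y, ‖x - y‖ₑ ^ (ε - finrank ℝ E) *
        oscillationTail μ G f p (ε + θ) ‖x - y‖ x ∂μ ∂μ =
      (∫⁻ z in ball (0 : E) 1, ‖z‖ₑ ^ (ε - finrank ℝ E) ∂μ) *
        ∫⁻ t in Ioi (0 : ℝ), ENNReal.ofReal t ^ (-(θ + 1)) *
          (∫⁻ x, maximalEnergy μ p (localOscillation μ G f t) x ∂μ) := by
  have hweight (β : ℝ) : Measurable (Function.uncurry fun (x : E) (t : ℝ) =>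
      ENNReal.ofReal t ^ (-(β + 1)) * maximalEnergy μ p (localOscillation μ G f t) x) :=
    (measurable_snd.ennreal_ofReal.pow_const _).mul
      (measurable_maximalEnergy_localOscillation μ hG hf p measurable_snd measurable_fst)
  have hrpow {t : ℝ} (ht : 0 < t) :
      ENNReal.ofReal t ^ ε * ENNReal.ofReal t ^ (-(ε + θ + 1)) = ENNReal.ofReal t ^ (-(θ + 1)) := by
    rw [← ENNReal.rpow_add _ _ (ENNReal.ofReal_pos.2 ht).ne' ENNReal.ofReal_ne_top]
    congr 1
    ring
  have hinner (x : E) : ∫⁻ y, ‖x - y‖ₑ ^ (ε - finrank ℝ E) *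
      oscillationTail μ G f p (ε + θ) ‖x - y‖ x ∂μ =
      (∫⁻ z in ball (0 : E) 1, ‖z‖ₑ ^ (ε - finrank ℝ E) ∂μ) * ∫⁻ t in Ioi (0 : ℝ),
        ENNReal.ofReal t ^ (-(θ + 1)) * maximalEnergy μ p (localOscillation μ G f t) x := by
    simp only [oscillationTail]
    rw [lintegral_enorm_sub_rpow_mul_setLIntegral_Ioi μ ε x (hweight (ε + θ)).of_uncurry_left]
    congr 1
    refine setLIntegral_congr_fun measurableSet_Ioi fun t (ht : 0 < t) => ?_
    rw [← mul_assoc, hrpow ht]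
  simp only [hinner]
  rw [lintegral_const_mul _ (hweight θ).lintegral_prod_right,
    lintegral_lintegral_swap (hweight θ).aemeasurable]
  congr 1
  exact lintegral_congr fun t => lintegral_const_mul _
    (measurable_maximalEnergy_localOscillation μ hG hf p measurable_const measurable_id)

theorem exists_lintegral_enorm_sub_rpow_mul_oscillationTail_le [Nontrivial E] {p ε : ℝ}
    (hp : 1 < p) (hε : 0 < ε) (T : ℝ) : ∃ C : ℝ≥0∞, C ≠ ∞ ∧ ∀ θ, 0 ≤ θ → θ ≤ T →
      ∀ {G : Set E}, MeasurableSet G → ∀ {f : E → F}, StronglyMeasurable f →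
        ∫⁻ x, ∫⁻ y, ‖x - y‖ₑ ^ (ε - finrank ℝ E) *
            oscillationTail μ G f p (ε + θ) ‖x - y‖ x ∂μ ∂μ ≤
          C * gagliardoEnergy μ G f p (finrank ℝ E + θ) := by
  obtain ⟨A, hA, hmax⟩ := exists_lintegral_maximalEnergy_le μ hp
  have hd : (1 : ℝ) ≤ finrank ℝ E := mod_cast finrank_pos (R := ℝ) (M := E)
  have hω : (μ (ball (0 : E) 1))⁻¹ ≠ ∞ := ENNReal.inv_ne_top.2 (measure_ball_pos μ 0 one_pos).ne'
  have hK := setLIntegral_ball_enorm_rpow_ne_top μ (E := E) hε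
  set K := ∫⁻ z in ball (0 : E) 1, ‖z‖ₑ ^ (ε - finrank ℝ E) ∂μ
  refine ⟨K * A * ((2 ^ finrank ℝ E) ^ (p - 1) * (μ (ball (0 : E) 1))⁻¹ *
    2 ^ (finrank ℝ E + T)), by finiteness, fun θ hθ hθT G hG f hf => ?_⟩
  have hconst : 2 ^ (finrank ℝ E + θ) / ENNReal.ofReal (finrank ℝ E + θ) ≤
      (2 : ℝ≥0∞) ^ (finrank ℝ E + T) := by
    refine (ENNReal.div_le_of_le_mul' ?_).trans
      (ENNReal.rpow_le_rpow_of_exponent_le one_le_two (add_le_add_right hθT _))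
    refine le_mul_of_one_le_left' ?_
    rw [ENNReal.one_le_ofReal]
    linarith
  calc _ = K * ∫⁻ t in Ioi (0 : ℝ), ENNReal.ofReal t ^ (-(θ + 1)) *
          (∫⁻ x, maximalEnergy μ p (localOscillation μ G f t) x ∂μ) :=
        lintegral_enorm_sub_rpow_mul_oscillationTail μ hG hf p θ ε
    _ ≤ K * ∫⁻ t in Ioi (0 : ℝ), A * (ENNReal.ofReal t ^ (-(θ + 1)) *
          (∫⁻ x, localOscillation μ G f t x ^ p ∂μ)) := by
        refine mul_le_mul_right (lintegral_mono fun t => ?_) K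
        rw [mul_left_comm]
        gcongr
        exact hmax _ (measurable_localOscillation μ hG hf).of_uncurry_left
    _ ≤ K * (A * ((2 ^ finrank ℝ E) ^ (p - 1) * (μ (ball (0 : E) 1))⁻¹ *
          2 ^ (finrank ℝ E + T) * gagliardoEnergy μ G f p (finrank ℝ E + θ))) := by
        rw [lintegral_const_mul' _ _ hA]
        gcongr
        refine (lintegral_rpow_mul_lintegral_localOscillation_rpow_le μ hp (by linarith)
          hG hf).trans ?_
        gcongr
    _ = _ := by ring

theorem measurable_maximalEnergy_diffQuotient (hG : MeasurableSet G) (hf : StronglyMeasurable f)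
    (p γ : ℝ) :
    Measurable (Function.uncurry fun x y => maximalEnergy μ p (diffQuotient G f γ y) x) := by
  have hQ : Measurable fun q : (E × E) × E => diffQuotient G f γ q.1.2 q.2 :=
    (measurable_diffQuotient hG hf γ).comp (measurable_fst.snd.prodMk measurable_snd)
  exact measurable_maximalEnergy μ p hQ measurable_fst

theorem measurable_halfMajorant (hG : MeasurableSet G) (hf : StronglyMeasurable f) (p θ ε : ℝ) :
    Measurable (Function.uncurry (halfMajorant μ G f p θ ε)) :=
  (measurable_maximalEnergy_diffQuotient μ hG hf p _).add
    (measurable_enorm_sub_rpow_mul_oscillationTail μ hG hf p _ _)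

theorem exists_lintegral_halfMajorant_le [Nontrivial E] {p ε : ℝ} (hp : 1 < p) (hε : 0 < ε)
    (T : ℝ) : ∃ C : ℝ≥0∞, C ≠ ∞ ∧ ∀ θ, 0 ≤ θ → θ ≤ T → ∀ {G : Set E}, MeasurableSet G →
      ∀ {f : E → F}, StronglyMeasurable f → ∫⁻ x, ∫⁻ y, halfMajorant μ G f p θ ε x y ∂μ ∂μ ≤
        C * gagliardoEnergy μ G f p (finrank ℝ E + θ) := by
  obtain ⟨A, hA, hmax⟩ := exists_lintegral_maximalEnergy_le μ hp
  obtain ⟨B, hB, htail⟩ :=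
    exists_lintegral_enorm_sub_rpow_mul_oscillationTail_le (F := F) μ hp hε T
  refine ⟨A + B, by finiteness, fun θ hθ hθT G hG f hf => ?_⟩
  have htailm := measurable_enorm_sub_rpow_mul_oscillationTail μ hG hf p (ε - finrank ℝ E) (ε + θ)
  simp only [halfMajorant]
  rw [lintegral_congr fun x => lintegral_add_right _ htailm.of_uncurry_left,
    lintegral_add_right _ htailm.lintegral_prod_right, add_mul]
  refine add_le_add ?_ (htail θ hθ hθT hG hf)
  rw [lintegral_lintegral_swap (measurable_maximalEnergy_diffQuotient μ hG hf p _).aemeasurable,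
    ← lintegral_diffQuotient_rpow μ hG (zero_lt_one.trans hp), ← lintegral_const_mul' _ _ hA]
  exact lintegral_mono fun y => hmax _ (measurable_diffQuotient hG hf _).of_uncurry_left

theorem exists_lintegral_majorant_le [Nontrivial E] {p ε : ℝ} (hp : 1 < p) (hε : 0 < ε)
    (T : ℝ) : ∃ C : ℝ≥0∞, C ≠ ∞ ∧ ∀ θ, 0 ≤ θ → θ ≤ T → ∀ {G : Set E}, MeasurableSet G →
      ∀ {f : E → F}, StronglyMeasurable f → ∫⁻ x, ∫⁻ y, majorant μ G f p θ ε x y ∂μ ∂μ ≤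
        C * gagliardoEnergy μ G f p (finrank ℝ E + θ) := by
  obtain ⟨C, hC, hhalf⟩ := exists_lintegral_halfMajorant_le (F := F) μ hp hε T
  refine ⟨2 * C, by finiteness, fun θ hθ hθT G hG f hf => ?_⟩
  have hm := measurable_halfMajorant μ hG hf p θ ε
  simp only [majorant]
  rw [lintegral_congr fun x => lintegral_add_left hm.of_uncurry_left _,
    lintegral_add_left hm.lintegral_prod_right, ← lintegral_lintegral_swap hm.aemeasurable,
    ← two_mul, mul_assoc]
  gcongr
  exact hhalf θ hθ hθT hG hf

end Majorant

section Comparison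

/-- A bound for the `p`-th power of the difference between the mean of `|f|` over a ball around `x`
and its mean over a suitable smaller ball around `y`, where `ρ` is the loss of radius. -/
noncomputable def comparisonBound {E F : Type*} [NormedAddCommGroup E] [NormedSpace ℝ E]
    [MeasurableSpace E] [SeminormedAddCommGroup F] (μ : Measure E) (G : Set E) (f : E → F)
    (p θ ε ρ : ℝ) (x y : E) : ℝ≥0∞ :=
  2 ^ (finrank ℝ E * p + ε + θ + p) *
    (ENNReal.ofReal ρ ^ (ε + θ) * ‖x - y‖ₑ ^ (finrank ℝ E - ε)) * majorant μ G f p θ ε x y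

theorem comparisonBound_comm {E F : Type*} [NormedAddCommGroup E] [NormedSpace ℝ E]
    [MeasurableSpace E] [SeminormedAddCommGroup F] (μ : Measure E) (G : Set E) (f : E → F)
    (p θ ε ρ : ℝ) (x y : E) :
    comparisonBound μ G f p θ ε ρ x y = comparisonBound μ G f p θ ε ρ y x := by
  rw [comparisonBound, comparisonBound, majorant_comm, enorm_sub_rev]

theorem enorm_sub_le_ofReal {E : Type*} [SeminormedAddCommGroup E] {x y : E} {ρ : ℝ}
    (h : dist x y ≤ ρ) : ‖x - y‖ₑ ≤ ENNReal.ofReal ρ := by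
  rw [← edist_eq_enorm_sub, edist_dist]
  exact ENNReal.ofReal_le_ofReal h

variable {E F : Type*} [NormedAddCommGroup E] [NormedSpace ℝ E] [MeasurableSpace E]
  [SeminormedAddCommGroup F] (μ : Measure E) {G : Set E} {f : E → F} {p θ ε ρ : ℝ} {x y : E}

theorem two_mul_enorm_sub_rpow_mul_rpow_le_comparisonBound (hp : 1 < p) (hθ : 0 ≤ θ) (hε : 0 ≤ ε)
    (hxy : x ≠ y) (hρ : dist x y ≤ ρ) {h : ℝ≥0∞}
    (hh : h ^ p ≤ maximalEnergy μ p (diffQuotient G f ((finrank ℝ E + θ) / p) y) x) :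
    ((2 * ‖x - y‖ₑ) ^ ((finrank ℝ E + θ) / p) * h) ^ p ≤ comparisonBound μ G f p θ ε ρ x y := by
  have hp0 : 0 < p := one_pos.trans hp
  have h0 : ‖x - y‖ₑ ≠ 0 := by simpa [sub_eq_zero] using hxy
  have hd : (finrank ℝ E : ℝ) ≤ finrank ℝ E * p :=
    le_mul_of_one_le_right (Nat.cast_nonneg _) hp.le
  have hweight : ‖x - y‖ₑ ^ (finrank ℝ E + θ) ≤
      ENNReal.ofReal ρ ^ (ε + θ) * ‖x - y‖ₑ ^ (finrank ℝ E - ε) := by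
    rw [show finrank ℝ E + θ = (ε + θ) + (finrank ℝ E - ε) by ring,
      ENNReal.rpow_add _ _ h0 enorm_ne_top]
    gcongr
    exact enorm_sub_le_ofReal hρ
  calc ((2 * ‖x - y‖ₑ) ^ ((finrank ℝ E + θ) / p) * h) ^ p
      = 2 ^ (finrank ℝ E + θ) * (‖x - y‖ₑ ^ (finrank ℝ E + θ) * h ^ p) := by
        rw [ENNReal.mul_rpow_of_nonneg _ _ hp0.le, ← ENNReal.rpow_mul, div_mul_cancel₀ _ hp0.ne',
          ENNReal.mul_rpow_of_nonneg _ _ (by positivity), mul_assoc]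
    _ ≤ comparisonBound μ G f p θ ε ρ x y := by
        rw [comparisonBound, mul_assoc]
        refine mul_le_mul' (ENNReal.rpow_le_rpow_of_exponent_le one_le_two (by linarith)) ?_
        gcongr
        exact hh.trans (le_self_add.trans le_self_add)

variable [BorelSpace E] [FiniteDimensional ℝ E] [μ.IsAddHaarMeasure]

theorem maximalEnergy_localOscillation_le_of_le (hp : 0 ≤ p) {t₀ t : ℝ} (ht₀ : 0 < t₀)
    (h : t₀ ≤ t) (h' : t ≤ 2 * t₀) (x : E) :
    maximalEnergy μ p (localOscillation μ G f t₀) x ≤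
      2 ^ (finrank ℝ E * p) * maximalEnergy μ p (localOscillation μ G f t) x := by
  rw [ENNReal.rpow_mul, ENNReal.rpow_natCast]
  exact maximalEnergy_le_of_le_const_mul μ hp (by finiteness)
    (localOscillation_le_of_le μ ht₀ h h') x

theorem maximalEnergy_localOscillation_le_oscillationTail (hp : 0 ≤ p) {β : ℝ} (hβ : 0 ≤ β)
    {t₀ δ : ℝ} (ht₀ : 0 < t₀) (hδ : δ ≤ t₀) (x : E) :
    maximalEnergy μ p (localOscillation μ G f t₀) x ≤
      2 ^ (finrank ℝ E * p + β + 1) *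
        (ENNReal.ofReal t₀ ^ β * oscillationTail μ G f p β δ x) := by
  have h0 : ENNReal.ofReal t₀ ≠ 0 := (ENNReal.ofReal_pos.2 ht₀).ne'
  set m := maximalEnergy μ p (localOscillation μ G f t₀) x
  set a : ℝ≥0∞ := (2 * ENNReal.ofReal t₀) ^ (-(β + 1)) with ha
  have hcancel : 2 ^ (β + 1) * ENNReal.ofReal t₀ ^ β * (a * ENNReal.ofReal t₀) = 1 := by
    calc 2 ^ (β + 1) * ENNReal.ofReal t₀ ^ β * (a * ENNReal.ofReal t₀)
        = (2 * ENNReal.ofReal t₀) ^ (β + 1) * a := by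
          rw [ENNReal.mul_rpow_of_nonneg _ _ (by linarith),
            ENNReal.rpow_add β 1 h0 ENNReal.ofReal_ne_top, ENNReal.rpow_one]
          ring
      _ = 1 := by
          rw [ha, ENNReal.rpow_neg, ENNReal.mul_inv_cancel _ (by finiteness)]
          exact (ENNReal.rpow_pos (by positivity) (by finiteness)).ne'
  -- Averaging over the scales `t ∈ (t₀, 2 t₀]` passes from a single scale to an integral.
  have hscale : a * ENNReal.ofReal t₀ * m ≤
      2 ^ (finrank ℝ E * p) * oscillationTail μ G f p β δ x := by
    calc a * ENNReal.ofReal t₀ * m = ∫⁻ _ in Ioc t₀ (2 * t₀), a * m := by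
          rw [setLIntegral_const, Real.volume_Ioc, two_mul, add_sub_cancel_right]
          ring
      _ ≤ ∫⁻ t in Ioc t₀ (2 * t₀), 2 ^ (finrank ℝ E * p) * (ENNReal.ofReal t ^ (-(β + 1)) *
            maximalEnergy μ p (localOscillation μ G f t) x) := by
          refine setLIntegral_mono' measurableSet_Ioc fun t ht => ?_
          rw [mul_left_comm]
          refine mul_le_mul' ?_
            (maximalEnergy_localOscillation_le_of_le μ hp ht₀ ht.1.le ht.2 x)
          rw [ha, ← ENNReal.ofReal_ofNat 2, ← ENNReal.ofReal_mul zero_le_two, ENNReal.rpow_neg,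
            ENNReal.rpow_neg]
          gcongr
          exact ht.2
      _ = 2 ^ (finrank ℝ E * p) * ∫⁻ t in Ioc t₀ (2 * t₀), ENNReal.ofReal t ^ (-(β + 1)) *
            maximalEnergy μ p (localOscillation μ G f t) x :=
          lintegral_const_mul' _ _ (by finiteness)
      _ ≤ _ := by
          gcongr
          exact lintegral_mono_set (Ioc_subset_Ioi_self.trans (Ioi_subset_Ioi hδ))
  calc m = 2 ^ (β + 1) * ENNReal.ofReal t₀ ^ β * (a * ENNReal.ofReal t₀ * m) := by
        rw [← mul_assoc, hcancel, one_mul]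
    _ ≤ 2 ^ (β + 1) * ENNReal.ofReal t₀ ^ β *
          (2 ^ (finrank ℝ E * p) * oscillationTail μ G f p β δ x) := by gcongr
    _ = _ := by
        rw [add_assoc, ENNReal.rpow_add (finrank ℝ E * p) _ two_ne_zero (by finiteness)]
        ring

theorem maximalEnergy_localOscillation_le_halfMajorant (hp : 0 ≤ p) (hβ : 0 ≤ ε + θ) {t₀ : ℝ}
    (hxy : x ≠ y) (ht₀ : dist x y ≤ t₀) (hρ : t₀ ≤ ρ) :
    maximalEnergy μ p (localOscillation μ G f t₀) x ≤
      2 ^ (finrank ℝ E * p + (ε + θ) + 1) *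
        (ENNReal.ofReal ρ ^ (ε + θ) * ‖x - y‖ₑ ^ (finrank ℝ E - ε)) *
        halfMajorant μ G f p θ ε x y := by
  have h0 : ‖x - y‖ₑ ≠ 0 := by simpa [sub_eq_zero] using hxy
  have hcancel : ‖x - y‖ₑ ^ (finrank ℝ E - ε) * ‖x - y‖ₑ ^ (ε - finrank ℝ E) = 1 := by
    rw [← ENNReal.rpow_add _ _ h0 enorm_ne_top, sub_add_sub_cancel, sub_self, ENNReal.rpow_zero]
  set tail := oscillationTail μ G f p (ε + θ) ‖x - y‖ x
  calc maximalEnergy μ p (localOscillation μ G f t₀) x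
      ≤ 2 ^ (finrank ℝ E * p + (ε + θ) + 1) * (ENNReal.ofReal t₀ ^ (ε + θ) * tail) :=
        maximalEnergy_localOscillation_le_oscillationTail μ hp hβ
          ((dist_pos.2 hxy).trans_le ht₀) (dist_eq_norm x y ▸ ht₀) x
    _ = 2 ^ (finrank ℝ E * p + (ε + θ) + 1) *
          (ENNReal.ofReal t₀ ^ (ε + θ) * ‖x - y‖ₑ ^ (finrank ℝ E - ε)) *
          (‖x - y‖ₑ ^ (ε - finrank ℝ E) * tail) := by
        rw [mul_assoc, mul_assoc (ENNReal.ofReal t₀ ^ _), ← mul_assoc (‖x - y‖ₑ ^ _), hcancel,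
          one_mul]
    _ ≤ _ := by
        gcongr
        exact le_add_self

theorem two_rpow_mul_maximalEnergy_add_le_comparisonBound (hp : 0 ≤ p) (hβ : 0 ≤ ε + θ) {t₀ : ℝ}
    (hxy : x ≠ y) (ht₀ : dist x y ≤ t₀) (hρ : t₀ ≤ ρ) :
    2 ^ (p - 1) * (maximalEnergy μ p (localOscillation μ G f t₀) x +
        maximalEnergy μ p (localOscillation μ G f t₀) y) ≤
      comparisonBound μ G f p θ ε ρ x y := by
  have hx := maximalEnergy_localOscillation_le_halfMajorant μ (G := G) (f := f) hp hβ hxy ht₀ hρ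
  have hy := maximalEnergy_localOscillation_le_halfMajorant μ (G := G) (f := f) hp hβ hxy.symm
    (dist_comm x y ▸ ht₀) hρ
  rw [enorm_sub_rev y x] at hy
  refine (mul_le_mul_right (add_le_add hx hy) _).trans_eq ?_
  rw [← mul_add, ← mul_assoc, ← mul_assoc, ← ENNReal.rpow_add _ _ two_ne_zero (by finiteness),
    comparisonBound, majorant]
  ring_nf

end Comparison

section BallMean

/-- The mean of `‖f‖` over the ball `B(x, r)`, understood as `‖f x‖` for `r = 0`. -/
noncomputable def ballMean {X F : Type*} [PseudoMetricSpace X] [MeasurableSpace X]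
    [SeminormedAddCommGroup F] (μ : Measure X) (f : X → F) (x : X) (r : ℝ) : ℝ≥0∞ :=
  if r = 0 then ‖f x‖ₑ else ⨍⁻ y in ball x r, ‖f y‖ₑ ∂μ

theorem ballMean_zero {X F : Type*} [PseudoMetricSpace X] [MeasurableSpace X]
    [SeminormedAddCommGroup F] (μ : Measure X) (f : X → F) (x : X) : ballMean μ f x 0 = ‖f x‖ₑ :=
  if_pos rfl

theorem ballMean_of_pos {X F : Type*} [PseudoMetricSpace X] [MeasurableSpace X]
    [SeminormedAddCommGroup F] (μ : Measure X) (f : X → F) (x : X) {r : ℝ} (hr : 0 < r) :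
    ballMean μ f x r = ⨍⁻ y in ball x r, ‖f y‖ₑ ∂μ :=
  if_neg hr.ne'

variable {E F : Type*} [NormedAddCommGroup E] [NormedSpace ℝ E] [FiniteDimensional ℝ E]
  [MeasurableSpace E] [BorelSpace E] [SeminormedAddCommGroup F] (μ : Measure E)
  [μ.IsAddHaarMeasure] {G : Set E} {f : E → F} {p θ ε ρ : ℝ} {x y : E}

theorem ballMean_le_enorm_add_comparisonBound (hp : 1 < p) (hθ : 0 ≤ θ) (hε : 0 ≤ ε) {r : ℝ}
    (hr : 0 ≤ r) (hball : ball x r ⊆ G) (hx : x ∈ G) (hy : y ∈ G) (hxy : x ≠ y)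
    (hρ : dist x y ≤ ρ) (hrρ : r ≤ ρ) :
    ballMean μ f x r ≤ ‖f y‖ₑ + comparisonBound μ G f p θ ε ρ x y ^ p⁻¹ := by
  have hp0 : 0 < p := one_pos.trans hp
  have hγ : 0 ≤ (finrank ℝ E + θ) / p := by positivity
  rcases hr.eq_or_lt with rfl | hr0
  · rw [ballMean_zero]
    refine (enorm_le_enorm_add_enorm_sub (f y) (f x)).trans (add_le_add_right ?_ _)
    rw [ENNReal.le_rpow_inv_iff hp0]
    refine le_trans ?_ (two_mul_enorm_sub_rpow_mul_rpow_le_comparisonBound μ hp hθ hε hxy hρ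
      (le_self_add (b := hlMaximal μ _ x ^ p)))
    gcongr
    refine (enorm_sub_le_rpow_mul_diffQuotient f hγ hx hy).trans ?_
    rw [enorm_sub_rev]
    gcongr
    exact le_mul_of_one_le_left' one_le_two
  rw [ballMean_of_pos μ f x hr0]
  rcases le_total r (dist x y) with hrd | hrd
  · refine (setLAverage_le_enorm_add_rpow_mul_hlMaximal μ f hγ hr0 hrd hball hy).trans
      (add_le_add_right ?_ _)
    rw [ENNReal.le_rpow_inv_iff hp0]
    exact two_mul_enorm_sub_rpow_mul_rpow_le_comparisonBound μ hp hθ hε hxy hρ le_add_self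
  · refine (setLAverage_le_enorm_add_localOscillation μ hr0 hball hy hrd).trans
      (add_le_add_right ?_ _)
    rw [ENNReal.le_rpow_inv_iff hp0]
    refine le_trans ?_ (two_rpow_mul_maximalEnergy_add_le_comparisonBound μ hp0.le
      (add_nonneg hε hθ) hxy hrd hrρ)
    exact (le_self_add.trans le_add_self).trans
      (le_mul_of_one_le_left' (ENNReal.one_le_rpow one_le_two (sub_pos.2 hp)))

theorem ballMean_le_ballMean_sub_add_comparisonBound (hp : 1 < p) (hβ : 0 ≤ ε + θ)
    (hG : MeasurableSet G) (hf : StronglyMeasurable f) {r : ℝ} (hball : ball x r ⊆ G) (hxy : x ≠ y)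
    (hρ : dist x y ≤ ρ) (hρr : ρ < r) :
    ballMean μ f x r ≤ ballMean μ f y (r - ρ) + comparisonBound μ G f p θ ε ρ x y ^ p⁻¹ := by
  have hp0 : 0 < p := one_pos.trans hp
  have hρ0 : 0 < ρ := (dist_pos.2 hxy).trans_le hρ
  rw [ballMean_of_pos μ f x (hρ0.trans hρr), ballMean_of_pos μ f y (sub_pos.2 hρr)]
  refine (setLAverage_le_setLAverage_add_hlMaximal μ hG hf hρ0 hρr hball hρ).trans
    (add_le_add_right ?_ _)
  rw [ENNReal.le_rpow_inv_iff hp0]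
  refine (ENNReal.rpow_add_le_mul_rpow_add_rpow _ _ hp.le).trans (le_trans ?_
    (two_rpow_mul_maximalEnergy_add_le_comparisonBound μ hp0.le hβ hxy hρ le_rfl))
  gcongr <;> exact le_add_self

theorem exists_ballMean_le_ballMean_add (hp : 1 < p) (hθ : 0 ≤ θ) (hε : 0 ≤ ε)
    (hG : MeasurableSet G) (hf : StronglyMeasurable f) {r : ℝ} (hr : 0 ≤ r) (hball : ball x r ⊆ G)
    (hx : x ∈ G) (hy : y ∈ G) (hxy : x ≠ y) (hρ : dist x y ≤ ρ) :
    ∃ r', 0 ≤ r' ∧ r' ≤ max 0 (r - ρ) ∧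
      ballMean μ f x r ≤ ballMean μ f y r' + comparisonBound μ G f p θ ε ρ x y ^ p⁻¹ := by
  rcases le_or_gt r ρ with hrρ | hρr
  · refine ⟨0, le_rfl, le_max_left _ _, ?_⟩
    rw [ballMean_zero μ f y]
    exact ballMean_le_enorm_add_comparisonBound μ hp hθ hε hr hball hx hy hxy hρ hrρ
  · exact ⟨r - ρ, (sub_pos.2 hρr).le, le_max_right _ _,
      ballMean_le_ballMean_sub_add_comparisonBound μ hp (add_nonneg hε hθ) hG hf hball hxy hρ hρr⟩

end BallMean

section RestrictedMaximal

/-- The maximal function of `f` in which the radii of the balls around `x` are at most `R x`. -/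
noncomputable def restrictedMaximal {X F : Type*} [PseudoMetricSpace X] [MeasurableSpace X]
    [SeminormedAddCommGroup F] (μ : Measure X) (R : X → ℝ) (f : X → F) (x : X) : ℝ≥0∞ :=
  ⨆ (r : ℝ) (_ : 0 ≤ r ∧ r ≤ R x), ballMean μ f x r

variable {X F : Type*} [PseudoMetricSpace X] [MeasurableSpace X] [SeminormedAddCommGroup F]
  (μ : Measure X) {G : Set X} {R : X → ℝ} {f g : X → F}

theorem ballMean_le_restrictedMaximal (f : X → F) {x : X} {r : ℝ} (hr : 0 ≤ r) (hrR : r ≤ R x) :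
    ballMean μ f x r ≤ restrictedMaximal μ R f x :=
  le_iSup₂ (f := fun r (_ : 0 ≤ r ∧ r ≤ R x) => ballMean μ f x r) r ⟨hr, hrR⟩

theorem restrictedMaximal_ae_eq (hG : MeasurableSet G) (hRG : ∀ x ∈ G, ball x (R x) ⊆ G)
    (hfg : f =ᵐ[μ.restrict G] g) :
    restrictedMaximal μ R f =ᵐ[μ.restrict G] restrictedMaximal μ R g := by
  filter_upwards [hfg, ae_restrict_mem hG] with x hx hxG
  refine iSup_congr fun r => iSup_congr fun hr => ?_
  rcases hr.1.eq_or_lt with rfl | hr0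
  · rw [ballMean_zero, ballMean_zero, hx]
  · rw [ballMean_of_pos μ f x hr0, ballMean_of_pos μ g x hr0]
    refine laverage_congr ?_
    filter_upwards [ae_restrict_of_ae_restrict_of_subset
      ((ball_subset_ball hr.2).trans (hRG x hxG)) hfg] with y hy
    rw [hy]

theorem restrictedMaximal_le_sup_hlMaximal [OpensMeasurableSpace X] (f : X → F) {x : X}
    (hx : ball x (R x) ⊆ G) :
    restrictedMaximal μ R f x ≤ ‖f x‖ₑ ⊔ hlMaximal μ (G.indicator fun y => ‖f y‖ₑ) x := by
  refine iSup₂_le fun r hr => ?_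
  rcases hr.1.eq_or_lt with rfl | hr0
  · exact (ballMean_zero μ f x).trans_le le_sup_left
  · rw [ballMean_of_pos μ f x hr0]
    refine le_trans (le_of_eq ?_) ((setLAverage_ball_le_hlMaximal μ _ x r).trans le_sup_right)
    refine setLAverage_congr_fun measurableSet_ball fun y hy => ?_
    simp only [indicator_of_mem (hx (ball_subset_ball hr.2 hy))]

theorem restrictedMaximal_eq_sup_iSup_rat (f : X → F) {x : X} (hx : 0 ≤ R x) :
    restrictedMaximal μ R f x = ‖f x‖ₑ ⊔
      ⨆ (q : ℚ) (_ : 0 < (q : ℝ) ∧ (q : ℝ) < R x), ⨍⁻ y in ball x q, ‖f y‖ₑ ∂μ := by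
  refine le_antisymm (iSup₂_le fun r hr => ?_) (sup_le ?_ (iSup₂_le fun q hq => ?_))
  · rcases hr.1.eq_or_lt with rfl | hr0
    · exact (ballMean_zero μ f x).trans_le le_sup_left
    · rw [ballMean_of_pos μ f x hr0]
      refine (setLAverage_ball_le_iSup_rat μ _ x r).trans (le_trans ?_ le_sup_right)
      exact iSup_mono fun q => iSup_const_mono fun hq => ⟨hq.1, hq.2.trans_le hr.2⟩
  · exact (ballMean_zero μ f x).symm.trans_le (ballMean_le_restrictedMaximal μ f le_rfl hx)
  · exact (ballMean_of_pos μ f x hq.1).symm.trans_le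
      (ballMean_le_restrictedMaximal μ f hq.1.le hq.2.le)

theorem aemeasurable_restrictedMaximal [OpensMeasurableSpace X] [SecondCountableTopology X]
    [SFinite μ] (hG : MeasurableSet G) (hR : AEMeasurable R (μ.restrict G))
    (hR₀ : ∀ x ∈ G, 0 ≤ R x) (hRG : ∀ x ∈ G, ball x (R x) ⊆ G)
    (hf : AEStronglyMeasurable f (μ.restrict G)) :
    AEMeasurable (restrictedMaximal μ R f) (μ.restrict G) := by
  obtain ⟨g, hg, hfg⟩ := hf
  obtain ⟨R', hR', hRR'⟩ := hR
  have hmeas : Measurable fun x => ‖g x‖ₑ ⊔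
      ⨆ (q : ℚ) (_ : 0 < (q : ℝ) ∧ (q : ℝ) < R' x), ⨍⁻ y in ball x q, ‖g y‖ₑ ∂μ := by
    simp only [iSup_eq_if]
    refine hg.enorm.sup (.iSup fun q => .ite ?_ ?_ measurable_const)
    · exact (MeasurableSet.const _).inter (measurableSet_lt measurable_const hR')
    · exact measurable_setLAverage_ball μ (F := fun _ y => ‖g y‖ₑ) (hg.enorm.comp measurable_snd)
        measurable_id measurable_const
  refine ⟨_, hmeas, (restrictedMaximal_ae_eq μ hG hRG hfg).trans ?_⟩
  filter_upwards [hRR', ae_restrict_mem hG] with x hx hxG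
  rw [restrictedMaximal_eq_sup_iSup_rat μ g (hR₀ x hxG), hx]

theorem hlMaximal_congr_ae {g h : X → ℝ≥0∞} (hgh : g =ᵐ[μ] h) : hlMaximal μ g = hlMaximal μ h :=
  funext fun _ => iSup_congr fun _ => laverage_congr (ae_restrict_of_ae hgh)

end RestrictedMaximal

section Finiteness

variable {E F : Type*} [NormedAddCommGroup E] [NormedSpace ℝ E] [FiniteDimensional ℝ E]
  [MeasurableSpace E] [BorelSpace E] [SeminormedAddCommGroup F] (μ : Measure E)
  [μ.IsAddHaarMeasure] {G : Set E} {R : E → ℝ} {f : E → F} {p : ℝ}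

theorem ae_hlMaximal_lt_top (hp : 1 < p) {g : E → ℝ≥0∞} (hg : AEMeasurable g μ)
    (hgp : ∫⁻ x, g x ^ p ∂μ ≠ ∞) : ∀ᵐ x ∂μ, hlMaximal μ g x < ∞ := by
  obtain ⟨g', hg', hgg'⟩ := hg
  have hgp' : ∫⁻ x, g' x ^ p ∂μ ≠ ∞ :=
    (lintegral_congr_ae (hgg'.fun_comp (· ^ p))).symm.trans_ne hgp
  rw [hlMaximal_congr_ae μ hgg']
  have hM : Measurable (hlMaximal μ g') :=
    measurable_hlMaximal μ (F := fun _ => g') (hg'.comp measurable_snd) measurable_id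
  have hMp : ∫⁻ x, hlMaximal μ g' x ^ p ∂μ ≠ ∞ := by
    obtain ⟨C, hC, hle⟩ := exists_lintegral_maximalEnergy_le μ hp
    exact ne_top_of_le_ne_top (ENNReal.mul_ne_top hC hgp')
      ((lintegral_mono fun x => le_add_self).trans (hle g' hg'))
  filter_upwards [ae_lt_top (hM.pow_const p) hMp] with x hx
  exact (ENNReal.rpow_lt_top_iff_of_pos (one_pos.trans hp)).1 hx

theorem ae_restrictedMaximal_lt_top (hp : 1 < p) (hG : MeasurableSet G)
    (hRG : ∀ x ∈ G, ball x (R x) ⊆ G) (hf : MemLp f (ENNReal.ofReal p) (μ.restrict G)) :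
    ∀ᵐ x ∂μ.restrict G, restrictedMaximal μ R f x < ∞ := by
  have hp0 : 0 < p := one_pos.trans hp
  have hind : ∫⁻ x, G.indicator (fun y => ‖f y‖ₑ) x ^ p ∂μ ≠ ∞ := by
    have hfp := lintegral_rpow_enorm_lt_top_of_eLpNorm_lt_top (ENNReal.ofReal_pos.2 hp0).ne'
      ENNReal.ofReal_ne_top hf.eLpNorm_lt_top
    rw [ENNReal.toReal_ofReal hp0.le, ← lintegral_indicator hG] at hfp
    refine (lintegral_congr fun x => ?_).trans_ne hfp.ne
    by_cases hx : x ∈ G <;> simp [hx, hp0]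
  have hM := ae_hlMaximal_lt_top μ hp
    ((aemeasurable_indicator_iff hG).2 hf.aestronglyMeasurable.enorm) hind
  filter_upwards [ae_restrict_of_ae hM, ae_restrict_mem hG] with x hx hxG
  exact (restrictedMaximal_le_sup_hlMaximal μ f (hRG x hxG)).trans_lt (max_lt enorm_lt_top hx)

end Finiteness

section MaximalDifference

theorem enorm_toReal_sub_toReal_le {a b c : ℝ≥0∞} (ha : a ≠ ∞) (hb : b ≠ ∞) (hab : a ≤ b + c)
    (hba : b ≤ a + c) : ‖a.toReal - b.toReal‖ₑ ≤ c := by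
  rcases eq_or_ne c ∞ with rfl | hc
  · exact le_top
  have hab' := ENNReal.toReal_le_add hab hb hc
  have hba' := ENNReal.toReal_le_add hba ha hc
  rw [Real.enorm_eq_ofReal_abs]
  exact ENNReal.ofReal_le_of_le_toReal (abs_sub_le_iff.2 ⟨by linarith, by linarith⟩)

theorem gagliardoEnergy_congr_ae {E F : Type*} [NormedAddCommGroup E] [MeasurableSpace E]
    [SeminormedAddCommGroup F] (μ : Measure E) {G : Set E} {f g : E → F}
    (hfg : f =ᵐ[μ.restrict G] g) (p α : ℝ) :
    gagliardoEnergy μ G f p α = gagliardoEnergy μ G g p α := by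
  refine lintegral_congr_ae ?_
  filter_upwards [hfg] with x hx
  refine lintegral_congr_ae ?_
  filter_upwards [hfg] with y hy
  rw [hx, hy]

variable {E F : Type*} [NormedAddCommGroup E] [NormedSpace ℝ E] [FiniteDimensional ℝ E]
  [MeasurableSpace E] [BorelSpace E] [SeminormedAddCommGroup F] (μ : Measure E)
  [μ.IsAddHaarMeasure] {G : Set E} {R : E → ℝ} {f : E → F} {p θ ε : ℝ} {x y : E}

theorem restrictedMaximal_le_restrictedMaximal_add (hp : 1 < p) (hθ : 0 ≤ θ) (hε : 0 ≤ ε)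
    (hG : MeasurableSet G) (hR₀ : ∀ x ∈ G, 0 ≤ R x) (hRG : ∀ x ∈ G, ball x (R x) ⊆ G)
    (hf : StronglyMeasurable f) (hx : x ∈ G) (hy : y ∈ G) (hxy : x ≠ y) :
    restrictedMaximal μ R f x ≤ restrictedMaximal μ R f y +
      comparisonBound μ G f p θ ε (dist x y + |R x - R y|) x y ^ p⁻¹ := by
  refine iSup₂_le fun r ⟨hr, hrR⟩ => ?_
  obtain ⟨r', hr', hr'_le, hle⟩ := exists_ballMean_le_ballMean_add μ hp hθ hε hG hf hr
    ((ball_subset_ball hrR).trans (hRG x hx)) hx hy hxy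
    (le_add_of_nonneg_right (abs_nonneg (R x - R y)))
  have hr'R : r' ≤ R y := hr'_le.trans <| max_le (hR₀ y hy) <| by
    linarith [le_abs_self (R x - R y), dist_nonneg (x := x) (y := y)]
  exact hle.trans (add_le_add_left (ballMean_le_restrictedMaximal μ f hr' hr'R) _)

theorem enorm_restrictedMaximal_sub_rpow_div_le (hp : 1 < p) (hθ : 0 ≤ θ) (hε : 0 ≤ ε)
    (hG : MeasurableSet G) (hR₀ : ∀ x ∈ G, 0 ≤ R x) (hRG : ∀ x ∈ G, ball x (R x) ⊆ G)
    (hf : StronglyMeasurable f) (hx : x ∈ G) (hy : y ∈ G) (hMx : restrictedMaximal μ R f x ≠ ∞)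
    (hMy : restrictedMaximal μ R f y ≠ ∞) :
    ‖(restrictedMaximal μ R f x).toReal - (restrictedMaximal μ R f y).toReal‖ₑ ^ p /
        ((‖x - y‖ₑ + ‖R x - R y‖ₑ) ^ (ε + θ) * ‖x - y‖ₑ ^ (finrank ℝ E - ε)) ≤
      2 ^ (finrank ℝ E * p + ε + θ + p) * majorant μ G f p θ ε x y := by
  have hp0 : 0 < p := one_pos.trans hp
  rcases eq_or_ne x y with rfl | hxy
  · simp [hp0]
  have hρ : ENNReal.ofReal (dist x y + |R x - R y|) = ‖x - y‖ₑ + ‖R x - R y‖ₑ := by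
    rw [ENNReal.ofReal_add dist_nonneg (abs_nonneg _), dist_eq_norm, ofReal_norm,
      Real.enorm_eq_ofReal_abs]
  have hle := restrictedMaximal_le_restrictedMaximal_add μ hp hθ hε hG hR₀ hRG hf hx hy hxy
  have hge := restrictedMaximal_le_restrictedMaximal_add μ hp hθ hε hG hR₀ hRG hf hy hx hxy.symm
  rw [dist_comm, abs_sub_comm, comparisonBound_comm] at hge
  refine ENNReal.div_le_of_le_mul ?_
  rw [mul_right_comm, ← hρ, ← comparisonBound, ← ENNReal.le_rpow_inv_iff hp0]
  exact enorm_toReal_sub_toReal_le hMx hMy hle hge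

theorem exists_lintegral_enorm_restrictedMaximal_sub_le (F : Type*) [SeminormedAddCommGroup F]
    [Nontrivial E] (hp : 1 < p) (hε : 0 < ε) (T : ℝ) :
    ∃ C : ℝ≥0∞, C ≠ ∞ ∧ ∀ θ, 0 ≤ θ → θ ≤ T → ∀ {G : Set E} {R : E → ℝ} {f : E → F},
      MeasurableSet G → (∀ x ∈ G, 0 ≤ R x) → (∀ x ∈ G, ball x (R x) ⊆ G) →
      AEStronglyMeasurable f (μ.restrict G) →
      (∀ᵐ x ∂μ.restrict G, restrictedMaximal μ R f x < ∞) →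
      ∫⁻ x in G, ∫⁻ y in G,
          ‖(restrictedMaximal μ R f x).toReal - (restrictedMaximal μ R f y).toReal‖ₑ ^ p /
            ((‖x - y‖ₑ + ‖R x - R y‖ₑ) ^ (ε + θ) * ‖x - y‖ₑ ^ (finrank ℝ E - ε)) ∂μ ∂μ ≤
        C * gagliardoEnergy μ G f p (finrank ℝ E + θ) := by
  obtain ⟨B, hB, hmajorant⟩ := exists_lintegral_majorant_le (F := F) μ hp hε T
  refine ⟨2 ^ (finrank ℝ E * p + ε + T + p) * B, by finiteness, ?_⟩
  intro θ hθ hθT G R f hG hR₀ hRG hf hfin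
  obtain ⟨g, hg, hfg⟩ := hf
  set A : ℝ≥0∞ := 2 ^ (finrank ℝ E * p + ε + θ + p)
  have hpoint : ∀ᵐ x ∂μ.restrict G, x ∈ G ∧
      restrictedMaximal μ R f x = restrictedMaximal μ R g x ∧ restrictedMaximal μ R g x ≠ ∞ := by
    filter_upwards [ae_restrict_mem hG, restrictedMaximal_ae_eq μ hG hRG hfg, hfin] with x hx hM hMx
    exact ⟨hx, hM, hM ▸ hMx.ne⟩
  calc _ ≤ ∫⁻ x in G, ∫⁻ y in G, A * majorant μ G g p θ ε x y ∂μ ∂μ := by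
        refine lintegral_mono_ae ?_
        filter_upwards [hpoint] with x ⟨hx, hMx, hMx_top⟩
        refine lintegral_mono_ae ?_
        filter_upwards [hpoint] with y ⟨hy, hMy, hMy_top⟩
        rw [hMx, hMy]
        exact enorm_restrictedMaximal_sub_rpow_div_le μ hp hθ hε.le hG hR₀ hRG hg hx hy hMx_top
          hMy_top
    _ = A * ∫⁻ x in G, ∫⁻ y in G, majorant μ G g p θ ε x y ∂μ ∂μ := by
        simp_rw [lintegral_const_mul' A _ (by finiteness)]
    _ ≤ A * ∫⁻ x, ∫⁻ y, majorant μ G g p θ ε x y ∂μ ∂μ := by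
        gcongr <;> exact Measure.restrict_le_self
    _ ≤ 2 ^ (finrank ℝ E * p + ε + T + p) *
          (B * gagliardoEnergy μ G g p (finrank ℝ E + θ)) := by
        gcongr
        · exact ENNReal.rpow_le_rpow_of_exponent_le one_le_two (by linarith)
        · exact hmajorant θ hθ hθT hG hg
    _ = _ := by rw [mul_assoc, gagliardoEnergy_congr_ae μ hfg]

end MaximalDifference

theorem theorem1p1_general {E F : Type*} [NormedAddCommGroup E] [NormedSpace ℝ E]
    [FiniteDimensional ℝ E] [Nontrivial E] [MeasurableSpace E] [BorelSpace E]
    [SeminormedAddCommGroup F] (μ : Measure E) [μ.IsAddHaarMeasure] {p ε : ℝ} (hp : 1 < p)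
    (hε : 0 < ε) (S : ℝ) :
    ∃ C : ℝ, 0 < C ∧ ∀ s, 0 ≤ s → s ≤ S → ∀ G : Set E, MeasurableSet G →
      ∀ R : E → ℝ, AEMeasurable R (μ.restrict G) → (∀ x ∈ G, 0 ≤ R x) →
      (∀ x ∈ G, ball x (R x) ⊆ G) → ∀ f : E → F, MemLp f (ENNReal.ofReal p) (μ.restrict G) →
        AEMeasurable (restrictedMaximal μ R f) (μ.restrict G) ∧
        (∀ᵐ x ∂μ.restrict G, restrictedMaximal μ R f x < ∞) ∧
        ∫⁻ x in G, ∫⁻ y in G,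
            ‖(restrictedMaximal μ R f x).toReal - (restrictedMaximal μ R f y).toReal‖ₑ ^ p /
              ((‖x - y‖ₑ + ‖R x - R y‖ₑ) ^ (ε + s * p) * ‖x - y‖ₑ ^ (finrank ℝ E - ε)) ∂μ ∂μ ≤
          ENNReal.ofReal C * gagliardoEnergy μ G f p (finrank ℝ E + s * p) := by
  have hp0 : 0 < p := one_pos.trans hp
  obtain ⟨C, hC, hbound⟩ := exists_lintegral_enorm_restrictedMaximal_sub_le μ F hp hε (S * p)
  have hC_le : C ≤ ENNReal.ofReal (C.toReal + 1) :=
    (ENNReal.ofReal_toReal hC).symm.trans_le (ENNReal.ofReal_le_ofReal (by linarith))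
  refine ⟨C.toReal + 1, by positivity, fun s hs hsS G hG R hR hR₀ hRG f hf => ?_⟩
  have hfin := ae_restrictedMaximal_lt_top μ hp hG hRG hf
  refine ⟨aemeasurable_restrictedMaximal μ hG hR hR₀ hRG hf.aestronglyMeasurable, hfin, ?_⟩
  exact (hbound (s * p) (mul_nonneg hs hp0.le) (mul_le_mul_of_nonneg_right hsS hp0.le) hG hR₀ hRG
    hf.aestronglyMeasurable hfin).trans (by gcongr)

section EuclideanSpace

theorem subset_of_isPreconnected_of_disjoint_frontier {X : Type*} [TopologicalSpace X] {s t : Set X}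
    (hs : IsPreconnected s) (hst : (s ∩ t).Nonempty) (hd : Disjoint s (frontier t)) : s ⊆ t := by
  have hcover : s ⊆ interior t ∪ (closure t)ᶜ := fun x hx => by
    by_contra hxt
    simp only [mem_union, mem_compl_iff, not_or, not_not] at hxt
    exact disjoint_left.1 hd hx ⟨hxt.2, hxt.1⟩
  obtain ⟨x, hxs, hxt⟩ := hst
  have hx : x ∈ interior t := (hcover hxs).resolve_right fun h => h (subset_closure hxt)
  exact (hs.subset_left_of_subset_union isOpen_interior isClosed_closure.isOpen_compl
    (disjoint_compl_right.mono_left (interior_subset.trans subset_closure)) hcover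
    ⟨x, hxs, hx⟩).trans interior_subset

theorem ball_subset_of_le_infEDist_frontier {E : Type*} [SeminormedAddCommGroup E] [NormedSpace ℝ E]
    {G : Set E} {x : E} (hx : x ∈ G) {r : ℝ}
    (hr : ENNReal.ofReal r ≤ infEDist x (frontier G)) : ball x r ⊆ G := by
  rcases le_or_gt r 0 with hr0 | hr0
  · simp [ball_eq_empty.2 hr0]
  refine subset_of_isPreconnected_of_disjoint_frontier (convex_ball x r).isPreconnected
    ⟨x, mem_ball_self hr0, hx⟩ (disjoint_left.2 fun z hz hzG => ?_)
  have hle := hr.trans (infEDist_le_edist_of_mem hzG)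
  rw [edist_dist, ENNReal.ofReal_le_ofReal_iff dist_nonneg, dist_comm] at hle
  exact (mem_ball.1 hz).not_ge hle

variable {n : ℕ} {G : Set (EuclideanSpace ℝ (Fin n))}

theorem IsAdmissibleRadius.ball_subset {R : EuclideanSpace ℝ (Fin n) → ℝ}
    (hR : IsAdmissibleRadius G R) : ∀ x ∈ G, ball x (R x) ⊆ G :=
  fun x hx => ball_subset_of_le_infEDist_frontier hx (hR.le_dist x hx)

theorem fracSobolevSeminorm_rpow {p : ℝ} (hp : p ≠ 0) (s : ℝ)
    (f : EuclideanSpace ℝ (Fin n) → ℝ) :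
    fracSobolevSeminorm s p G f ^ p = gagliardoEnergy volume G f p (n + s * p) := by
  rw [fracSobolevSeminorm, ← ENNReal.rpow_mul, one_div_mul_cancel hp, ENNReal.rpow_one,
    gagliardoEnergy]

end EuclideanSpace

theorem theorem1p1 (n : ℕ) (hn : 1 ≤ n) (p ε : ℝ) (hp : 1 < p) (hε0 : 0 < ε) (hε1 : ε < 1) :
    ∃ C : ℝ, 0 < C ∧
      ∀ (s : ℝ), 0 < s → s < 1 →
      ∀ (G : Set (EuclideanSpace ℝ (Fin n))), IsOpen G → G.Nonempty →
      ∀ (R : EuclideanSpace ℝ (Fin n) → ℝ), IsAdmissibleRadius G R →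
      ∀ (f : EuclideanSpace ℝ (Fin n) → ℝ), MemLp f (ENNReal.ofReal p) (volume.restrict G) →
        AEMeasurable (maximalR R f) (volume.restrict G) ∧
        (∀ᵐ x ∂(volume.restrict G), maximalR R f x < ∞) ∧
        (∫⁻ x in G, ∫⁻ y in G,
            ‖(maximalR R f x).toReal - (maximalR R f y).toReal‖ₑ ^ p /
              ((‖x - y‖ₑ + ‖R x - R y‖ₑ) ^ (ε + s * p) * ‖x - y‖ₑ ^ ((n : ℝ) - ε)))
          ≤ ENNReal.ofReal C * fracSobolevSeminorm s p G f ^ p := by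
  have : Nonempty (Fin n) := ⟨0, hn⟩
  obtain ⟨C, hC, h⟩ := theorem1p1_general (E := EuclideanSpace ℝ (Fin n)) (F := ℝ) volume hp hε0 1
  rw [finrank_euclideanSpace_fin] at h
  refine ⟨C, hC, fun s hs0 hs1 G hG _ R hR f hf => ?_⟩
  rw [fracSobolevSeminorm_rpow (one_pos.trans hp).ne']
  exact h s hs0.le hs1.le G hG.measurableSet R hR.measurable hR.nonneg hR.ball_subset f hf
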